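/- Let $S$ be a set of $k\ge 0$ steps partially ordered by $\leqslant$, let $U$ be a set of $n\ge 1$ users, let $A\subseteq S\times U$ be an authorization relation, and let $U^{(1)},\dots,U^{(\ell)}$ be a canonical organizational $\ell$-hierarchy on $U$: partitions of $U$ into nonempty blocks such that $U^{(i)}$ is a refinement of $U^{(i+1)}$ and $U^{(i)}\neq U^{(i+1)}$ for $1\le i<\ell$, $U^{(\ell)}=\{U\}$, and $U^{(1)}$ consists of all singletons. Write $u\sim_i v$ if $u$ and $v$ lie in the same block of $U^{(i)}$, and $u\not\sim_i v$ otherwise. Let $C$ be a collection of $c$ constraints $(\rho,S_1,S_2)$ of Type 2, that is, with $\rho\in\{\sim_1,\not\sim_1,\dots,\sim_\ell,\not\sim_\ell\}$, $S_1,S_2\subseteq S$, and at least one of $S_1,S_2$ a singleton. A plan is a function $\pi:S\to U$; it satisfies $(\rho,S_1,S_2)$ if $(\pi(s_1),\pi(s_2))\in\rho$ for some $s_1\in S_1$, $s_2\in S_2$; it is valid if $(s,\pi(s))\in A$ for all $s\in S$ and $\pi$ satisfies every constraint in $C$. The workflow satisfiability problem asks for a valid plan, or for the answer that there is none. There is an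 algorithm that solves this problem on all such inputs $(S,U,\leqslant,A,C)$, $U^{(1)},\dots,U^{(\ell)}$ in time $\widetilde{O}(3^k n(c+n))$. Precisely: there are one program for a random access machine, with time measured by logarithmic cost, and constants $K,d$ such that on each input with parameters $n,k,c$ (and any $\ell$) the program outputs a valid plan, or reports correctly that there is none, within time $K\,T(\lfloor\log_2 T\rfloor+1)^d$, where $T=3^k n(c+n)$. -/

import Mathlib

/-! ## Workflows, entailment constraints and plans -/

namespace WSP

/-- An entailment constraint `(ρ, S₁, S₂)` over the set of steps `S`; the relation `ρ` on users is
named by a symbol from `R`. -/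
structure Constraint (R S : Type*) where
  rel : R
  left : Finset S
  right : Finset S

/-- At least one of the two step sets is a singleton (constraints in which both are singletons,
those of Type 1, are included). -/
def Constraint.IsType2 {R S : Type*} (γ : Constraint R S) : Prop :=
  γ.left.card = 1 ∨ γ.right.card = 1

/-- A constrained workflow authorization schema `(S, U, ≤, A, C)` with `c` constraints whose
relations are named by symbols from `R`. -/
structure Workflow (S U R : Type*) (c : ℕ) where
  le : S → S → Prop
  isPartialOrder : IsPartialOrder S le
  auth : S → U → Prop
  con : Fin c → Constraint R S

/-- The plan `π` satisfies the constraint `γ`, when the relation symbols are interpreted by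
`interp`. -/
def Constraint.SatisfiedBy {R S U : Type*} (interp : R → U → U → Prop) (γ : Constraint R S)
    (π : S → U) : Prop :=
  ∃ s₁ ∈ γ.left, ∃ s₂ ∈ γ.right, interp γ.rel (π s₁) (π s₂)

/-- A plan is valid if it is authorized and satisfies all constraints. -/
def Workflow.IsValid {R S U : Type*} {c : ℕ} (interp : R → U → U → Prop) (W : Workflow S U R c)
    (π : S → U) : Prop :=
  (∀ s, W.auth s (π s)) ∧ ∀ j, (W.con j).SatisfiedBy interp π

/-! ## Organizational hierarchies -/

/-- An organizational `ℓ`-hierarchy: `ℓ` partitions of the user set (into nonempty blocks), each a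
refinement of the next one. The index `i : Fin ℓ` stands for the level `i + 1`. -/
structure Hierarchy (U : Type*) [Fintype U] [DecidableEq U] (ℓ : ℕ) where
  level : Fin ℓ → Finpartition (Finset.univ : Finset U)
  refines : ∀ (i : ℕ) (h : i + 1 < ℓ), level ⟨i, Nat.lt_of_succ_lt h⟩ ≤ level ⟨i + 1, h⟩

/-- Consecutive levels differ, the top level is `{U}` and the bottom level consists of all
singletons. -/
structure Hierarchy.IsCanonical {U : Type*} [Fintype U] [DecidableEq U] {ℓ : ℕ}
    (H : Hierarchy U ℓ) : Prop where
  pos : 0 < ℓ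
  ne_succ : ∀ (i : ℕ) (h : i + 1 < ℓ),
    H.level ⟨i, Nat.lt_of_succ_lt h⟩ ≠ H.level ⟨i + 1, h⟩
  top : (H.level ⟨ℓ - 1, Nat.sub_lt pos Nat.one_pos⟩).parts = {Finset.univ}
  bot : (H.level ⟨0, pos⟩).parts = Finset.univ.image (fun u : U => ({u} : Finset U))

/-- The relations `∼ᵢ` and `≁ᵢ` of a hierarchy with `ℓ` levels, as symbols. -/
inductive RelSymbol (ℓ : ℕ) where
  | same (i : Fin ℓ)
  | diff (i : Fin ℓ)

/-- `u` and `v` lie in the same block of level `i`. -/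
def Hierarchy.Same {U : Type*} [Fintype U] [DecidableEq U] {ℓ : ℕ} (H : Hierarchy U ℓ)
    (i : Fin ℓ) (u v : U) : Prop :=
  ∃ B ∈ (H.level i).parts, u ∈ B ∧ v ∈ B

/-- The meaning of the relation symbols. -/
def Hierarchy.interp {U : Type*} [Fintype U] [DecidableEq U] {ℓ : ℕ} (H : Hierarchy U ℓ) :
    RelSymbol ℓ → U → U → Prop
  | .same i, u, v => H.Same i u v
  | .diff i, u, v => ¬ H.Same i u v

/-! ## The machine model

Random access machine with logarithmic cost, in the form of structured programs. The memory
consists of arrays of natural numbers of unbounded length; a program mentions finitely many of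
them, by name. Every elementary operation costs one plus the binary lengths of the numbers (indices
included) that it handles. -/

/-- `m a i` is the content of cell `i` of array `a`. -/
abbrev Mem := ℕ → ℕ → ℕ

/-- The arithmetic operations: addition, truncated subtraction, multiplication and
integer division (with `x / 0 = 0`). -/
inductive Op where
  | add
  | sub
  | mul
  | div

def Op.apply : Op → ℕ → ℕ → ℕ
  | .add, x, y => x + y
  | .sub, x, y => x - y
  | .mul, x, y => x * y
  | .div, x, y => x / y

/-- Expressions: constants, the content of a cell of a named array, arithmetic. -/
inductive Exp where
  | const (v : ℕ)
  | read (a : ℕ) (idx : Exp)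
  | op (o : Op) (x y : Exp)

def Exp.eval (m : Mem) : Exp → ℕ
  | .const v => v
  | .read a idx => m a (idx.eval m)
  | .op o x y => o.apply (x.eval m) (y.eval m)

/-- The cost of evaluating an expression; `Nat.size` is the binary length. -/
def Exp.cost (m : Mem) : Exp → ℕ
  | .const v => 1 + v.size
  | .read a idx => idx.cost m + (1 + (idx.eval m).size + (m a (idx.eval m)).size)
  | .op _ x y => x.cost m + y.cost m + (1 + (x.eval m).size + (y.eval m).size)

/-- Programs. -/
inductive Cmd where
  | skip
  | store (a : ℕ) (idx val : Exp)
  | seq (p q : Cmd)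
  | ite (b : Exp) (p q : Cmd)
  | loop (b : Exp) (p : Cmd)

/-- Writing `v` into cell `i` of array `a`. -/
def Mem.write (m : Mem) (a i v : ℕ) : Mem :=
  fun a' i' => if a' = a ∧ i' = i then v else m a' i'

/-- `Exec p m t m'`: the program `p`, started in the memory `m`, halts after time `t` in the memory
`m'`. A test succeeds if its value is not zero; `loop b p` repeats `p` while the test `b`
succeeds. -/
inductive Exec : Cmd → Mem → ℕ → Mem → Prop
  | skip (m : Mem) : Exec .skip m 1 m
  | store (m : Mem) (a : ℕ) (idx val : Exp) :
      Exec (.store a idx val) m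
        (idx.cost m + val.cost m + (1 + (idx.eval m).size + (val.eval m).size))
        (m.write a (idx.eval m) (val.eval m))
  | seq {p q : Cmd} {m m₁ m₂ : Mem} {t₁ t₂ : ℕ} :
      Exec p m t₁ m₁ → Exec q m₁ t₂ m₂ → Exec (.seq p q) m (t₁ + t₂) m₂
  | ite_true {b : Exp} {p q : Cmd} {m m' : Mem} {t : ℕ} :
      b.eval m ≠ 0 → Exec p m t m' → Exec (.ite b p q) m (b.cost m + 1 + t) m'
  | ite_false {b : Exp} {p q : Cmd} {m m' : Mem} {t : ℕ} :
      b.eval m = 0 → Exec q m t m' → Exec (.ite b p q) m (b.cost m + 1 + t) m'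
  | loop_stop {b : Exp} {p : Cmd} {m : Mem} :
      b.eval m = 0 → Exec (.loop b p) m (b.cost m + 1) m
  | loop_step {b : Exp} {p : Cmd} {m m₁ m₂ : Mem} {t₁ t₂ : ℕ} :
      b.eval m ≠ 0 → Exec p m t₁ m₁ → Exec (.loop b p) m₁ t₂ m₂ →
      Exec (.loop b p) m (b.cost m + 1 + t₁ + t₂) m₂

/-! ## Input and output -/

/-- `lab` numbers the blocks of every level of `H` by natural numbers less than `n`: `lab i u` is
the number of the block of level `i` that contains the user `u`. -/
def IsLabelling {n ℓ : ℕ} (H : Hierarchy (Fin n) ℓ) (lab : Fin ℓ → Fin n → ℕ) : Prop :=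
  ∀ i u, lab i u < n ∧ ∀ v, lab i u = lab i v ↔ H.Same i u v

/-- The array of length `p` with entries `f`, followed by zeros. -/
def vector {p : ℕ} (f : Fin p → ℕ) (x : ℕ) : ℕ :=
  if h : x < p then f ⟨x, h⟩ else 0

/-- A `p` by `q` table written row by row, followed by zeros: `f i j` stands in
cell `q * i + j`. -/
def table {p q : ℕ} (f : Fin p → Fin q → ℕ) : ℕ → ℕ :=
  vector (fun x : Fin (p * q) => f (finProdFinEquiv.symm x).1 (finProdFinEquiv.symm x).2)

open Classical in
/-- `1` if the proposition holds and `0` otherwise. -/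
noncomputable def bit (P : Prop) : ℕ := if P then 1 else 0

def RelSymbol.sign {ℓ : ℕ} : RelSymbol ℓ → ℕ
  | .same _ => 0
  | .diff _ => 1

def RelSymbol.index {ℓ : ℕ} : RelSymbol ℓ → ℕ
  | .same i => i
  | .diff i => i

/-- The initial memory: the numbers of users, steps, constraints and levels; the order on the steps;
the authorization relation; for every constraint `(ρ, S₁, S₂)` its kind, its level and the
characteristic vectors of `S₁` and `S₂`; and for every level and user the number of the
user's block. All other cells are zero. -/
noncomputable def inputMem {n k c ℓ : ℕ} (W : Workflow (Fin k) (Fin n) (RelSymbol ℓ) c)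
    (lab : Fin ℓ → Fin n → ℕ) : Mem
  | 0 => vector ![n, k, c, ℓ]
  | 1 => table (fun s s' : Fin k => bit (W.le s s'))
  | 2 => table (fun (s : Fin k) (u : Fin n) => bit (W.auth s u))
  | 3 => vector (fun j => (W.con j).rel.sign)
  | 4 => vector (fun j => (W.con j).rel.index)
  | 5 => table (fun j s => bit (s ∈ (W.con j).left))
  | 6 => table (fun j s => bit (s ∈ (W.con j).right))
  | 7 => table lab
  | _ => fun _ => 0

/-- The final memory `m` answers the workflow satisfiability problem, in array `8`: either a `1`
followed by a valid plan, or a `0` if there is no valid plan. -/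
def IsAnswer {n k c ℓ : ℕ} (H : Hierarchy (Fin n) ℓ)
    (W : Workflow (Fin k) (Fin n) (RelSymbol ℓ) c) (m : Mem) : Prop :=
  (m 8 0 = 1 ∧ ∃ π : Fin k → Fin n, W.IsValid H.interp π ∧ ∀ s : Fin k, m 8 (s + 1) = π s) ∨
  (m 8 0 = 0 ∧ ¬ ∃ π : Fin k → Fin n, W.IsValid H.interp π)

/-- The bound `K · T · (log T + 1) ^ d`; a time bound of this form with constants `K` and `d` is
what `Õ(T)` means (the summand `1` matters only for `T = 1`). -/
def softBound (K d T : ℕ) : ℕ := K * (T * (Nat.log 2 T + 1) ^ d)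

end WSP

/-! ## Cost and correctness of programs -/

namespace WSP

/-! The algorithm rests on a local criterion for Type 2 constraints. Fix a plan and, for each block
of level `i`, let `F` be the set of steps assigned to users of that block. A constraint on level `i`
fails exactly when some single nonempty `F` witnesses the failure: for `≁ᵢ`, `F` contains `S₁ ∪ S₂`;
for `∼ᵢ`, `F` contains one of `S₁`, `S₂` and misses the other. The witnessing block is that of the
step in the singleton, and this is where Type 2 enters (`exists_ne_iff`, `exists_eq_iff`,
`satisfiedBy_iff`). So every level has a list of bad sets, depending on the constraints alone, and a
plan is valid iff it is authorized and no block of any level receives a bad set (`isValid_iff`).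

This permits dynamic programming up the hierarchy. For a set `X` of users, a table gives for each
set `F` of steps an authorized plan from `F` to `X` that respects the lower levels, if there is one
(`Inst.Rep`). Single users have explicit tables. Inside one block of level `i` the only set to be
tested on that level is `F` itself, so passing to the next level erases the bad entries
(`Inst.Rep.filter`). If `X` and `Y` share no block of the levels considered, plans for `X ∪ Y` are
pairs of plans on disjoint sets of steps (`Inst.Rep.union`). A block is the union of its children,
hence its table arises by successive merges, and the table of the top block, filtered once more,
decides the problem at the full set of steps.

A merge visits the `3 ^ k` ordered pairs of disjoint sets of steps, enumerated as ternary numbers.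
Plans are stored as numbers in base `n`, increased by one, so that gluing two plans is one addition.
The levels of a canonical hierarchy lose at least one block at each step, so `ℓ ≤ n`
(`Hierarchy.IsCanonical.levels_le_card`). With one merge per user and level this gives about `n² 3 ^
k` operations, and the bad sets take about `c 2 ^ k k`. Factors `k`, `log n` and `log c`, including
the length of the plan codes, are polylogarithmic in `T` (`steps_le`, `time_le`).

The program is verified by a Hoare logic with running times, `Does`, in which every operation on
words of `w` bits costs a constant multiple of `w + 1`. -/

instance : Add Exp := ⟨.op .add⟩
instance : Sub Exp := ⟨.op .sub⟩
instance : Mul Exp := ⟨.op .mul⟩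
instance : Div Exp := ⟨.op .div⟩
instance (v : ℕ) : OfNat Exp v := ⟨.const v⟩

/-- The scalar variable kept in cell `0` of the array `a`. -/
def Exp.var (a : ℕ) : Exp := .read a 0

section Eval
variable (m : Mem) (x y : Exp) (a : ℕ)

@[simp] theorem Exp.eval_add : (x + y).eval m = x.eval m + y.eval m := rfl
@[simp] theorem Exp.eval_sub : (x - y).eval m = x.eval m - y.eval m := rfl
@[simp] theorem Exp.eval_mul : (x * y).eval m = x.eval m * y.eval m := rfl
@[simp] theorem Exp.eval_div : (x / y).eval m = x.eval m / y.eval m := rfl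
@[simp] theorem Exp.eval_zero : (0 : Exp).eval m = 0 := rfl
@[simp] theorem Exp.eval_one : (1 : Exp).eval m = 1 := rfl
@[simp] theorem Exp.eval_two : (2 : Exp).eval m = 2 := rfl
@[simp] theorem Exp.eval_three : (3 : Exp).eval m = 3 := rfl
@[simp] theorem Exp.eval_var : (Exp.var a).eval m = m a 0 := rfl
@[simp] theorem Exp.eval_read : (Exp.read a x).eval m = m a (x.eval m) := rfl

end Eval

/-- A bound for the binary length of the value of an expression, in multiples of the word length. -/
def Exp.width : Exp → ℕ
  | .const v => v
  | .read _ _ => 1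
  | .op _ x y => x.width + y.width + 1

/-- A bound for the cost of an expression, in multiples of the word length. -/
def Exp.weight : Exp → ℕ
  | .const v => 1 + v
  | .read _ idx => idx.weight + idx.width + 2
  | .op _ x y => x.weight + y.weight + x.width + y.width + 1

/-- All cells hold numbers of at most `w` bits. -/
def Bounded (w : ℕ) (m : Mem) : Prop := ∀ a i, m a i < 2 ^ w

theorem size_le_self (v : ℕ) : v.size ≤ v := Nat.size_le.2 Nat.lt_two_pow_self

theorem Op.size_apply_le (o : Op) (x y : ℕ) : (o.apply x y).size ≤ x.size + y.size + 1 := by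
  have hx := Nat.lt_size_self x
  have hy := Nat.lt_size_self y
  cases o
  · refine Nat.size_le.2 ?_
    have h1 : 2 ^ x.size ≤ 2 ^ (x.size + y.size) := Nat.pow_le_pow_right (by simp) (by simp)
    have h2 : 2 ^ y.size ≤ 2 ^ (x.size + y.size) := Nat.pow_le_pow_right (by simp) (by simp)
    simp only [Op.apply, pow_succ]
    omega
  · exact (Nat.size_le_size (Nat.sub_le x y)).trans (by omega)
  · refine Nat.size_le.2 ?_
    calc x * y < 2 ^ x.size * 2 ^ y.size := Nat.mul_lt_mul'' hx hy
      _ ≤ _ := by rw [← pow_add]; exact Nat.pow_le_pow_right (by simp) (by simp)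
  · exact (Nat.size_le_size (Nat.div_le_self x y)).trans (by omega)

theorem Exp.size_eval_le {w : ℕ} {m : Mem} (hm : Bounded w m) (e : Exp) :
    (e.eval m).size ≤ e.width * (w + 1) := by
  induction e with
  | const v => exact (size_le_self v).trans (Nat.le_mul_of_pos_right _ (by simp))
  | read a idx _ =>
    have := Nat.size_le.2 (hm a (idx.eval m))
    simp only [Exp.eval, Exp.width]
    omega
  | op o x y hx hy =>
    have := o.size_apply_le (x.eval m) (y.eval m)
    simp only [Exp.eval, Exp.width]
    nlinarith

/-- A fixed expression over words of `w` bits handles only numbers of `O(w)` bits, because one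
operation at most adds the lengths of its arguments plus one. The weight does not depend on the
memory, so the weights of concrete expressions are found by `decide`. -/
theorem Exp.cost_le {w : ℕ} {m : Mem} (hm : Bounded w m) (e : Exp) :
    e.cost m ≤ e.weight * (w + 1) := by
  induction e with
  | const v =>
    have := size_le_self v
    simp only [Exp.cost, Exp.weight]
    nlinarith
  | read a idx h =>
    have h1 := Nat.size_le.2 (hm a (idx.eval m))
    have h2 := idx.size_eval_le hm
    simp only [Exp.cost, Exp.weight]
    nlinarith
  | op o x y hx hy =>
    have h1 := x.size_eval_le hm
    have h2 := y.size_eval_le hm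
    simp only [Exp.cost, Exp.weight]
    nlinarith

/-- The arrays that a program may modify. -/
def Cmd.mods : Cmd → List ℕ
  | .skip => []
  | .store a _ _ => [a]
  | .seq p q => p.mods ++ q.mods
  | .ite _ p q => p.mods ++ q.mods
  | .loop _ p => p.mods

/-- The memories agree outside of the arrays in `l`. -/
def AgreeOff (l : List ℕ) (m m' : Mem) : Prop := ∀ a, a ∉ l → m' a = m a

theorem write_of_ne {m : Mem} {a i v b : ℕ} (h : b ≠ a) : m.write a i v b = m b := by
  funext j
  simp [Mem.write, h]

theorem write_apply {m : Mem} {a i v j : ℕ} :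
    m.write a i v a j = if j = i then v else m a j := by
  simp [Mem.write]

@[simp] theorem write_self {m : Mem} {a i v : ℕ} : m.write a i v a i = v := by
  simp [Mem.write]

/-- The frame rule: `Cmd.mods` is a computable list, so for a concrete program it is decidable which
arrays survive, and postconditions need not mention them. -/
theorem Exec.agreeOff {p : Cmd} {m m' : Mem} {t : ℕ} (h : Exec p m t m') :
    AgreeOff p.mods m m' := by
  induction h with
  | skip m => intro a _; rfl
  | store m b idx val => intro a ha; exact write_of_ne (by simpa [Cmd.mods] using ha)
  | seq _ _ h1 h2 =>
    intro a ha
    simp only [Cmd.mods, List.mem_append, not_or] at ha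
    rw [h2 a ha.2, h1 a ha.1]
  | ite_true _ _ h1 =>
    intro a ha
    simp only [Cmd.mods, List.mem_append, not_or] at ha
    exact h1 a ha.1
  | ite_false _ _ h1 =>
    intro a ha
    simp only [Cmd.mods, List.mem_append, not_or] at ha
    exact h1 a ha.2
  | loop_stop _ => intro a _; rfl
  | loop_step _ _ _ h1 h2 => intro a ha; rw [h2 a ha, h1 a ha]

theorem Bounded.write {w : ℕ} {m : Mem} (hm : Bounded w m) {a i v : ℕ} (hv : v < 2 ^ w) :
    Bounded w (m.write a i v) := by
  intro b j
  unfold Mem.write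
  split_ifs
  · exact hv
  · exact hm b j

/-- The program `p`, started in the memory `m` with word length `w`, halts after time at most
`N * (w + 1)`, keeps the word length, and ends in a memory with the property `Q`. -/
def Does (w : ℕ) (p : Cmd) (N : ℕ) (m : Mem) (Q : Mem → Prop) : Prop :=
  Bounded w m → ∃ t m', Exec p m t m' ∧ t ≤ N * (w + 1) ∧ Bounded w m' ∧ Q m'

/-! ### Proof rules for timed execution -/

namespace Does

variable {w N N₁ N₂ : ℕ} {p q : Cmd} {m : Mem} {Q R : Mem → Prop}

theorem mono (h : Does w p N₁ m Q) (hN : N₁ ≤ N₂) : Does w p N₂ m Q := fun hm => by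
  obtain ⟨t, m', h1, h2, h3, h4⟩ := h hm
  exact ⟨t, m', h1, h2.trans (Nat.mul_le_mul_right _ hN), h3, h4⟩

theorem imp (h : Does w p N m Q) (hQ : ∀ m', AgreeOff p.mods m m' → Q m' → R m') :
    Does w p N m R := fun hm => by
  obtain ⟨t, m', h1, h2, h3, h4⟩ := h hm
  exact ⟨t, m', h1, h2, h3, hQ m' h1.agreeOff h4⟩

theorem skip (h : Q m) : Does w .skip 1 m Q := fun hm =>
  ⟨1, m, .skip m, by omega, hm, h⟩

theorem store {a : ℕ} {i v : Exp} (hv : v.eval m < 2 ^ w)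
    (h : Q (m.write a (i.eval m) (v.eval m))) :
    Does w (.store a i v) (i.weight + v.weight + i.width + v.width + 1) m Q := fun hm => by
  refine ⟨_, _, .store m a i v, ?_, hm.write hv, h⟩
  have h1 := i.cost_le hm
  have h2 := v.cost_le hm
  have h3 := i.size_eval_le hm
  have h4 := v.size_eval_le hm
  nlinarith

theorem seq (h : Does w p N₁ m fun m' => AgreeOff p.mods m m' → Does w q N₂ m' Q) :
    Does w (.seq p q) (N₁ + N₂) m Q := fun hm => by
  obtain ⟨t, m', h1, h2, h3, h4⟩ := h hm
  obtain ⟨t', m'', h1', h2', h3', h4'⟩ := h4 h1.agreeOff h3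
  exact ⟨_, _, .seq h1 h1', by nlinarith, h3', h4'⟩

theorem ite {b : Exp} (h1 : b.eval m ≠ 0 → Does w p N m Q) (h2 : b.eval m = 0 → Does w q N m Q) :
    Does w (.ite b p q) (b.weight + 1 + N) m Q := fun hm => by
  have hb := b.cost_le hm
  by_cases h : b.eval m = 0
  · obtain ⟨t, m', e1, e2, e3, e4⟩ := h2 h hm
    exact ⟨_, _, .ite_false h e1, by nlinarith, e3, e4⟩
  · obtain ⟨t, m', e1, e2, e3, e4⟩ := h1 h hm
    exact ⟨_, _, .ite_true h e1, by nlinarith, e3, e4⟩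

end Does

/-- `for v = 0, …, e - 1 do p`. -/
def Cmd.forLoop (v : ℕ) (e : Exp) (p : Cmd) : Cmd :=
  .seq (.store v 0 0) (.loop (e - .var v) (.seq p (.store v 0 (.var v + 1))))

/-- The invariant is read after the counter has been set, that is, in the memory in which the next
test takes place. The bound `e` is evaluated anew in each round, so `he` demands the same value in
all memories that differ only in the arrays of the loop. Since subtraction is truncated, the test `e
- v` is nonzero exactly while the counter is below the bound. The summand `40` pays for test and
increment. -/
theorem Does.forLoop {w v cb C : ℕ} {e : Exp} {p : Cmd} {m : Mem} {Q : Mem → Prop} (N : ℕ)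
    (hC : cb + e.weight + e.width + 40 ≤ C) (I : ℕ → Mem → Prop) (hN : N < 2 ^ w) (hv : v ∉ p.mods)
    (he : ∀ m', AgreeOff (v :: p.mods) m m' → e.eval m' = N)
    (h0 : I 0 (m.write v 0 0))
    (hstep : ∀ j m', j < N → AgreeOff (v :: p.mods) m m' → m' v 0 = j → I j m' →
      Does w p cb m' fun m'' => AgreeOff p.mods m' m'' → I (j + 1) (m''.write v 0 (j + 1)))
    (hend : ∀ m', AgreeOff (v :: p.mods) m m' → I N m' → Q m') :
    Does w (.forLoop v e p) ((N + 1) * C) m Q := by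
  -- Induction on the number `d` of rounds that are still to come.
  have main : ∀ d j m', j + d = N → AgreeOff (v :: p.mods) m m' → m' v 0 = j → I j m' →
      Does w (.loop (e - .var v) (.seq p (.store v 0 (.var v + 1))))
        (d * (cb + (e.weight + e.width + 40)) + (e.weight + e.width + 20)) m' Q := by
    intro d
    induction d with
    | zero =>
      intro j m' hj hf hjv hI hm'
      have hc := (e - .var v).cost_le hm'
      refine ⟨_, _, Exec.loop_stop ?_, ?_, hm', hend m' hf (by simpa [← hj] using hI)⟩
      · simp [he m' hf, hjv, ← hj]
      · have : (e - .var v).weight = e.weight + 3 + e.width + 1 + 1 := rfl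
        rw [this] at hc
        nlinarith
    | succ d ih =>
      intro j m' hj hf hjv hI hm'
      have hc := (e - .var v).cost_le hm'
      obtain ⟨t₁, m₁, e1, e2, e3, e4⟩ := hstep j m' (by omega) hf hjv hI hm'
      have hv1 : m₁ v 0 = j := by rw [e1.agreeOff v hv, hjv]
      have hst : Does w (.store v 0 (.var v + 1)) 13 m₁ fun m'' =>
          m'' = m₁.write v 0 (j + 1) :=
        Does.store (by simp [hv1]; omega) (by simp [hv1])
      obtain ⟨t₂, m₂, s1, s2, s3, s4⟩ := hst e3
      have hf2 : AgreeOff (v :: p.mods) m m₂ := by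
        intro a ha
        simp only [List.mem_cons, not_or] at ha
        rw [s4, write_of_ne ha.1, e1.agreeOff a ha.2, hf a (by simp [ha])]
      obtain ⟨t₃, m₃, l1, l2, l3, l4⟩ := ih (j + 1) m₂ (by omega) hf2 (by simp [s4])
        (s4 ▸ e4 e1.agreeOff) s3
      refine ⟨_, _, .loop_step ?_ (.seq e1 s1) l1, ?_, l3, l4⟩
      · simp [he m' hf, hjv]; omega
      · have : (e - .var v).weight = e.weight + 3 + e.width + 1 + 1 := rfl
        rw [this] at hc
        nlinarith
  refine Does.mono (Does.seq (N₁ := 3) (N₂ := N * (cb + (e.weight + e.width + 40)) +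
    (e.weight + e.width + 20)) (Does.store (by simp) ?_)) (by nlinarith)
  intro _
  refine main N 0 _ (by simp) ?_ (by simp) h0
  intro a ha
  simp only [List.mem_cons, not_or] at ha
  exact write_of_ne ha.1

/-! ## Codes of step sets and of partial plans -/

open Finset

/-- The set `F` of steps as a number. -/
def mask (F : Finset ℕ) : ℕ := ∑ s ∈ F, 2 ^ s

/-- The restriction of the plan `π` to `F` as a number. -/
def code (n : ℕ) (π : ℕ → ℕ) (F : Finset ℕ) : ℕ := ∑ s ∈ F, π s * n ^ s

theorem mask_div_two_pow (F : Finset ℕ) (s : ℕ) :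
    mask F / 2 ^ s % 2 = if s ∈ F then 1 else 0 := by
  have h : s ∈ F ↔ (mask F).testBit s := by
    rw [← Nat.mem_bitIndices, ← List.mem_toFinset, mask, toFinset_bitIndices_sum_two_pow]
  rw [Nat.testBit_eq_decide_div_mod_eq, decide_eq_true_iff] at h
  split_ifs with hs
  · exact h.1 hs
  · have := mt h.2 hs
    omega

theorem mask_inj {F G : Finset ℕ} (h : mask F = mask G) : F = G := by
  ext s
  have h1 := mask_div_two_pow F s
  have h2 := mask_div_two_pow G s
  rw [h, h2] at h1
  split_ifs at h1 <;> simp_all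

theorem exists_mask_eq {k x : ℕ} (hx : x < 2 ^ k) : ∃ F ⊆ range k, mask F = x := by
  refine ⟨x.bitIndices.toFinset, fun s hs => ?_, sum_toFinset_bitIndices_two_pow x⟩
  rw [List.mem_toFinset] at hs
  have := Nat.two_pow_le_of_mem_bitIndices hs
  exact mem_range.2 ((Nat.pow_lt_pow_iff_right (by simp)).1 (this.trans_lt hx))

theorem mask_range (k : ℕ) : mask (range k) = 2 ^ k - 1 := by
  have := Nat.geomSum_eq (m := 2) le_rfl k
  simpa [mask] using this

theorem mask_lt {k : ℕ} {F : Finset ℕ} (hF : F ⊆ range k) : mask F < 2 ^ k := by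
  have h1 : mask F ≤ mask (range k) := sum_le_sum_of_subset hF
  have h2 : 0 < 2 ^ k := by positivity
  rw [mask_range] at h1
  omega

theorem mask_eq_zero {F : Finset ℕ} : mask F = 0 ↔ F = ∅ := by
  constructor
  · intro h
    exact mask_inj (h.trans (by simp [mask]))
  · rintro rfl
    simp [mask]

theorem mask_union {F G : Finset ℕ} (h : Disjoint F G) : mask (F ∪ G) = mask F + mask G :=
  sum_union h

theorem code_union {n : ℕ} {π : ℕ → ℕ} {F G : Finset ℕ} (h : Disjoint F G) :
    code n π (F ∪ G) = code n π F + code n π G :=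
  sum_union h

theorem code_congr {n : ℕ} {π π' : ℕ → ℕ} {F : Finset ℕ} (h : ∀ s ∈ F, π s = π' s) :
    code n π F = code n π' F :=
  sum_congr rfl fun s hs => by rw [h s hs]

theorem exists_glue {F G : Finset ℕ} (h : Disjoint F G) (π₁ π₂ : ℕ → ℕ) :
    ∃ π : ℕ → ℕ, (∀ s ∈ F, π s = π₁ s) ∧ ∀ s ∈ G, π s = π₂ s := by
  classical
  exact ⟨fun s => if s ∈ F then π₁ s else π₂ s, fun s hs => if_pos hs,
    fun s hs => if_neg fun h' => disjoint_left.1 h h' hs⟩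

theorem code_range_lt {n : ℕ} {π : ℕ → ℕ} (k : ℕ) (h : ∀ s < k, π s < n) :
    code n π (range k) < n ^ k := by
  induction k with
  | zero => simp [code]
  | succ k ih =>
    have h1 := ih fun s hs => h s (by omega)
    have h2 := h k (by omega)
    rw [code, sum_range_succ, ← code, pow_succ]
    calc _ < n ^ k + π k * n ^ k := by omega
      _ = (π k + 1) * n ^ k := by ring
      _ ≤ n * n ^ k := Nat.mul_le_mul_right _ h2
      _ = _ := by ring

/-- Steps outside `F` contribute nothing, as if they were given to user `0`; this makes the code a
number with `k` digits in base `n`. -/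
theorem code_lt {n k : ℕ} {π : ℕ → ℕ} {F : Finset ℕ} (hF : F ⊆ range k) (hn : 0 < n)
    (h : ∀ s ∈ F, π s < n) : code n π F < n ^ k := by
  have h1 : code n π F = code n (fun s => if s ∈ F then π s else 0) F :=
    code_congr fun s hs => by simp [hs]
  rw [h1]
  refine (sum_le_sum_of_subset hF).trans_lt (code_range_lt k fun s _ => ?_)
  split_ifs with hs
  · exact h s hs
  · exact hn

theorem code_range_div_mod {n k s : ℕ} {π : ℕ → ℕ} (h : ∀ s < k, π s < n) (hs : s < k) :
    code n π (range k) / n ^ s % n = π s := by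
  induction k with
  | zero => omega
  | succ k ih =>
    have hn : 0 < n := (Nat.zero_le _).trans_lt (h s hs)
    have hc := code_range_lt k fun s hs => h s (by omega)
    rw [code, sum_range_succ, ← code]
    rcases Nat.lt_succ_iff_lt_or_eq.1 hs with hs' | rfl
    · obtain ⟨d, rfl⟩ := Nat.exists_eq_add_of_lt hs'
      -- The leading term is a multiple of `n ^ (s + 1)` and does not affect the digit at place `s`.
      have : π (s + d + 1) * n ^ (s + d + 1) = n ^ s * (n * (π (s + d + 1) * n ^ d)) := by ring
      rw [this, Nat.add_mul_div_left _ _ (by positivity), Nat.add_mul_mod_self_left]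
      exact ih (fun s hs => h s (by omega)) hs'
    · rw [Nat.add_mul_div_right _ _ (by positivity), Nat.div_eq_of_lt hc, zero_add,
        Nat.mod_eq_of_lt (h s (by omega))]

/-! ### Pairs of disjoint sets as ternary numbers -/

/-- Replaces every ternary digit `d` of `t` by the binary digit `f d`. -/
def recode (f : ℕ → ℕ) (t : ℕ) : ℕ :=
  if h : t = 0 then 0 else 2 * recode f (t / 3) + f (t % 3)
decreasing_by exact Nat.div_lt_self (Nat.pos_of_ne_zero h) (by simp)

theorem recode_zero (f : ℕ → ℕ) : recode f 0 = 0 := by rw [recode]; simp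

/-- Since `f 0 = 0`, the recursion also holds at `t = 0`. A table of `recode f` can therefore be
filled in increasing order with a bounded number of operations per entry and no special case. -/
theorem recode_eq {f : ℕ → ℕ} (hf : f 0 = 0) (t : ℕ) :
    recode f t = 2 * recode f (t / 3) + f (t % 3) := by
  by_cases h : t = 0
  · simp [h, recode_zero, hf]
  · rw [recode, dif_neg h]

theorem recode_eq_sum {f : ℕ → ℕ} (hf : f 0 = 0) {k t : ℕ} (ht : t < 3 ^ k) :
    recode f t = ∑ s ∈ range k, f (t / 3 ^ s % 3) * 2 ^ s := by
  induction k generalizing t with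
  | zero =>
    have : t = 0 := by simpa using ht
    simp [this, recode_zero]
  | succ k ih =>
    rw [recode_eq hf, ih (t := t / 3) (by rw [pow_succ] at ht; omega), sum_range_succ', mul_sum]
    simp only [pow_zero, Nat.div_one, mul_one]
    congr 1
    refine sum_congr rfl fun s _ => ?_
    rw [Nat.div_div_eq_div_mul, pow_succ', pow_succ']
    ring

theorem exists_ternary (k : ℕ) (d : ℕ → ℕ) (hd : ∀ s < k, d s < 3) :
    ∃ t < 3 ^ k, ∀ s < k, t / 3 ^ s % 3 = d s := by
  refine ⟨code 3 d (range k), code_range_lt k hd, fun s hs => code_range_div_mod hd hs⟩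

/-- The ternary digit `1` marks the elements of the first set. -/
def recode₁ : ℕ → ℕ := recode fun d => d * (2 - d)

/-- The ternary digit `2` marks the elements of the second set. -/
def recode₂ : ℕ → ℕ := recode fun d => d / 2

theorem sum_ite_two_pow (k : ℕ) (p : ℕ → Prop) [DecidablePred p] :
    ∑ s ∈ range k, (if p s then 1 else 0) * 2 ^ s = mask ((range k).filter p) := by
  rw [mask, sum_filter]
  exact sum_congr rfl fun s _ => by split_ifs <;> simp

theorem recode₁_eq_mask {k t : ℕ} (ht : t < 3 ^ k) :
    recode₁ t = mask ((range k).filter fun s => t / 3 ^ s % 3 = 1) := by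
  rw [recode₁, recode_eq_sum (by simp) ht, ← sum_ite_two_pow]
  refine sum_congr rfl fun s _ => ?_
  have : t / 3 ^ s % 3 < 3 := Nat.mod_lt _ (by simp)
  congr 1
  interval_cases t / 3 ^ s % 3 <;> rfl

theorem recode₂_eq_mask {k t : ℕ} (ht : t < 3 ^ k) :
    recode₂ t = mask ((range k).filter fun s => t / 3 ^ s % 3 = 2) := by
  rw [recode₂, recode_eq_sum (by simp) ht, ← sum_ite_two_pow]
  refine sum_congr rfl fun s _ => ?_
  have : t / 3 ^ s % 3 < 3 := Nat.mod_lt _ (by simp)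
  congr 1
  interval_cases t / 3 ^ s % 3 <;> rfl

theorem exists_disjoint_of_lt {k t : ℕ} (ht : t < 3 ^ k) :
    ∃ F G, F ⊆ range k ∧ G ⊆ range k ∧ Disjoint F G ∧ recode₁ t = mask F ∧ recode₂ t = mask G := by
  refine ⟨_, _, filter_subset _ _, filter_subset _ _, ?_, recode₁_eq_mask ht, recode₂_eq_mask ht⟩
  rw [disjoint_filter]
  intro s _ h1 h2
  omega

/-- With `exists_disjoint_of_lt`, a loop over `t < 3 ^ k` visits exactly the ordered pairs of
disjoint sets of steps: each step is in the first set, in the second or in neither. This is the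
source of the factor `3 ^ k`. -/
theorem exists_lt_of_disjoint {k : ℕ} {F G : Finset ℕ} (hF : F ⊆ range k) (hG : G ⊆ range k)
    (h : Disjoint F G) : ∃ t < 3 ^ k, recode₁ t = mask F ∧ recode₂ t = mask G := by
  obtain ⟨t, ht, hd⟩ := exists_ternary k (fun s => if s ∈ F then 1 else if s ∈ G then 2 else 0)
    (fun s _ => by split_ifs <;> simp)
  refine ⟨t, ht, ?_, ?_⟩
  · rw [recode₁_eq_mask ht]
    congr 1
    ext s
    simp only [mem_filter, mem_range]
    constructor
    · rintro ⟨hs, h1⟩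
      rw [hd s hs] at h1
      by_contra hF'
      rw [if_neg hF'] at h1
      split_ifs at h1; omega
    · intro hs
      have hk := mem_range.1 (hF hs)
      exact ⟨hk, by rw [hd s hk, if_pos hs]⟩
  · rw [recode₂_eq_mask ht]
    congr 1
    ext s
    simp only [mem_filter, mem_range]
    constructor
    · rintro ⟨hs, h1⟩
      rw [hd s hs] at h1
      by_contra hG'
      rw [if_neg hG'] at h1
      split_ifs at h1; omega
    · intro hs
      have hk := mem_range.1 (hG hs)
      have hs' : s ∉ F := fun h' => disjoint_left.1 h h' hs
      exact ⟨hk, by rw [hd s hk, if_neg hs', if_pos hs]⟩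

/-! ## Instances over the natural numbers and tables of partial plans -/

/-- The data of an instance: steps, users, constraints and levels are natural numbers;
`au s u` is the authorization bit, `sg j` and `ix j` the kind and the level of the `j`-th constraint,
`s₁ j` and `s₂ j` are the characteristic functions of its step sets, and `L i u` is the block of the
user `u` at level `i`. -/
structure Inst where
  n : ℕ
  k : ℕ
  c : ℕ
  ℓ : ℕ
  au : ℕ → ℕ → ℕ
  sg : ℕ → ℕ
  ix : ℕ → ℕ
  s₁ : ℕ → ℕ → ℕ
  s₂ : ℕ → ℕ → ℕ
  L : ℕ → ℕ → ℕ

namespace Inst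

variable (I : Inst)

/-- The `j`-th constraint is violated by every plan that maps to a block of its level exactly the
steps in `F`. -/
def Viol (j : ℕ) (F : Finset ℕ) : Prop :=
  (I.sg j ≠ 0 ∧ (∀ s < I.k, I.s₁ j s ≠ 0 → s ∈ F) ∧ ∀ s < I.k, I.s₂ j s ≠ 0 → s ∈ F) ∨
  (I.sg j = 0 ∧
    (((∀ s < I.k, I.s₁ j s ≠ 0 → s ∈ F) ∧ ∀ s < I.k, I.s₂ j s ≠ 0 → s ∉ F) ∨
     ((∀ s < I.k, I.s₂ j s ≠ 0 → s ∈ F) ∧ ∀ s < I.k, I.s₁ j s ≠ 0 → s ∉ F)))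

/-- `F` must not be the set of the steps performed by a block of level `i`. -/
def Bad (i : ℕ) (F : Finset ℕ) : Prop := F.Nonempty ∧ ∃ j < I.c, I.ix j = i ∧ I.Viol j F

/-- `π` assigns the steps in `F` to authorized users in `X` and respects the constraints on the
levels below `i`. -/
def Ok (i : ℕ) (X : Set ℕ) (F : Finset ℕ) (π : ℕ → ℕ) : Prop :=
  (∀ s ∈ F, π s ∈ X ∧ I.au s (π s) ≠ 0) ∧
    ∀ i' < i, ∀ b, ¬ I.Bad i' (F.filter fun s => I.L i' (π s) = b)

/-- The table `T` lists for every set of steps the code of a plan, increased by one, or `0` if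
there is none. -/
def Rep (i : ℕ) (X : Set ℕ) (T : ℕ → ℕ) : Prop :=
  ∀ F ⊆ range I.k, (T (mask F) = 0 ∧ ¬ ∃ π, I.Ok i X F π) ∨
    ∃ π, I.Ok i X F π ∧ T (mask F) = code I.n π F + 1

variable {I} {i : ℕ} {X Y : Set ℕ} {T T₁ T₂ T₃ : ℕ → ℕ}

theorem Rep.ne_zero_iff (h : I.Rep i X T) {F : Finset ℕ} (hF : F ⊆ range I.k) :
    T (mask F) ≠ 0 ↔ ∃ π, I.Ok i X F π := by
  rcases h F hF with ⟨h0, h1⟩ | ⟨π, h1, h2⟩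
  · simp [h0, h1]
  · exact ⟨fun _ => ⟨π, h1⟩, fun _ => by omega⟩

theorem Rep.exists_code (h : I.Rep i X T) {F : Finset ℕ} (hF : F ⊆ range I.k)
    (h0 : T (mask F) ≠ 0) : ∃ π, I.Ok i X F π ∧ T (mask F) = code I.n π F + 1 :=
  (h F hF).resolve_left fun h' => h0 h'.1

/-- The left-hand side is again the code of a plan plus one, namely of the glued plan on `F ∪ G`.
Merging thus never leaves the word length. -/
theorem Rep.add_le (h₁ : I.Rep i X T₁) (h₂ : I.Rep i Y T₂) (hn : 0 < I.n)
    (hX : ∀ x ∈ X, x < I.n) (hY : ∀ x ∈ Y, x < I.n) {F G : Finset ℕ} (hF : F ⊆ range I.k)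
    (hG : G ⊆ range I.k) (hFG : Disjoint F G) (hF0 : T₁ (mask F) ≠ 0) (hG0 : T₂ (mask G) ≠ 0) :
    T₁ (mask F) + T₂ (mask G) - 1 ≤ I.n ^ I.k := by
  obtain ⟨π₁, ⟨o₁, -⟩, e₁⟩ := h₁.exists_code hF hF0
  obtain ⟨π₂, ⟨o₂, -⟩, e₂⟩ := h₂.exists_code hG hG0
  obtain ⟨π, hπF, hπG⟩ := exists_glue hFG π₁ π₂
  have h := code_lt (n := I.n) (π := π) (union_subset hF hG) hn (fun s hs => by
      rcases mem_union.1 hs with hs | hs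
      · rw [hπF s hs]
        exact hX _ (o₁ s hs).1
      · rw [hπG s hs]
        exact hY _ (o₂ s hs).1)
  rw [code_union hFG, code_congr hπF, code_congr hπG] at h
  omega

/-- By `sep` no block of a level below `i` meets both `X` and `Y`. Hence the set of steps of such a
block comes from one half of the plan only, and the conditions on a plan into `X ∪ Y` are those on
its two halves. A plan is split by whether the user lies in `X`; conversely two plans on disjoint
sets are glued and their codes added. -/
theorem Rep.union (h₁ : I.Rep i X T₁) (h₂ : I.Rep i Y T₂)
    (sep : ∀ i' < i, ∀ x ∈ X, ∀ y ∈ Y, I.L i' x ≠ I.L i' y)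
    (sound : ∀ H ⊆ range I.k, T₃ (mask H) ≠ 0 → ∃ F ⊆ range I.k, ∃ G ⊆ range I.k, Disjoint F G ∧
      F ∪ G = H ∧ T₁ (mask F) ≠ 0 ∧ T₂ (mask G) ≠ 0 ∧ T₃ (mask H) = T₁ (mask F) + T₂ (mask G) - 1)
    (complete : ∀ F ⊆ range I.k, ∀ G ⊆ range I.k, Disjoint F G → T₁ (mask F) ≠ 0 →
      T₂ (mask G) ≠ 0 → T₃ (mask (F ∪ G)) ≠ 0) :
    I.Rep i (X ∪ Y) T₃ := by
  classical
  intro H hH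
  by_cases h0 : T₃ (mask H) = 0
  · refine .inl ⟨h0, ?_⟩
    rintro ⟨π, ho, hb⟩
    have hsplit : H.filter (π · ∈ X) ∪ H.filter (π · ∉ X) = H := filter_union_filter_not_eq _ _
    have hY : ∀ s ∈ H, π s ∉ X → π s ∈ Y := fun s hs hX => (ho s hs).1.resolve_left hX
    -- A nonempty label class of the half selected by `p` is a full label class of `H`, because
    -- labels never agree across the two halves. So a bad class of the half would be a bad class of
    -- `π`.
    have ok : ∀ (Z : Set ℕ) (p : ℕ → Prop) [DecidablePred p], (∀ s ∈ H, p s → π s ∈ Z) →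
        (∀ i' < i, ∀ s ∈ H, ∀ s' ∈ H, p s → ¬ p s' → I.L i' (π s) ≠ I.L i' (π s')) →
        I.Ok i Z (H.filter p) π := by
      intro Z p _ hp hs
      refine ⟨fun s hs => ⟨hp s (mem_filter.1 hs).1 (mem_filter.1 hs).2,
        (ho s (mem_filter.1 hs).1).2⟩, fun i' hi' b hbad => ?_⟩
      obtain ⟨s, hs1⟩ := hbad.1
      simp only [mem_filter] at hs1
      refine hb i' hi' b ?_
      convert hbad using 1
      ext s'
      simp only [mem_filter]
      refine ⟨fun h => ⟨⟨h.1, ?_⟩, h.2⟩, fun h => ⟨h.1.1, h.2⟩⟩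
      by_contra hps
      exact hs i' hi' s hs1.1.1 s' h.1 hs1.1.2 hps (hs1.2.trans h.2.symm)
    refine complete _ ((filter_subset _ _).trans hH) _ ((filter_subset _ _).trans hH)
      (disjoint_filter_filter_not H H (π · ∈ X)) ?_ ?_ (by rw [hsplit]; exact h0)
    · refine (h₁.ne_zero_iff ((filter_subset _ _).trans hH)).2 ⟨π, ok X _ (fun s _ h => h) ?_⟩
      intro i' hi' s hs s' hs' h h'
      exact sep i' hi' _ h _ (hY s' hs' h')
    · refine (h₂.ne_zero_iff ((filter_subset _ _).trans hH)).2 ⟨π, ok Y _ (fun s hs h => hY s hs h) ?_⟩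
      intro i' hi' s hs s' hs' h h'
      exact (sep i' hi' _ (not_not.1 h') _ (hY s hs h)).symm
  · right
    obtain ⟨F, hF, G, hG, hFG, rfl, hF0, hG0, e⟩ := sound H hH h0
    obtain ⟨π₁, ⟨o₁, b₁⟩, e₁⟩ := h₁.exists_code hF hF0
    obtain ⟨π₂, ⟨o₂, b₂⟩, e₂⟩ := h₂.exists_code hG hG0
    obtain ⟨π, hπF, hπG⟩ := exists_glue hFG π₁ π₂
    refine ⟨π, ⟨fun s hs => ?_, fun i' hi' b hbad => ?_⟩, ?_⟩
    · rcases mem_union.1 hs with hs | hs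
      · rw [hπF s hs]
        exact ⟨.inl (o₁ s hs).1, (o₁ s hs).2⟩
      · rw [hπG s hs]
        exact ⟨.inr (o₂ s hs).1, (o₂ s hs).2⟩
    · rw [filter_union, filter_congr (q := fun s => I.L i' (π₁ s) = b)
        (fun s hs => by rw [hπF s hs]), filter_congr (s := G) (q := fun s => I.L i' (π₂ s) = b)
        (fun s hs => by rw [hπG s hs])] at hbad
      -- At most one of the two halves has steps with label `b`.
      by_cases hne : (F.filter fun s => I.L i' (π₁ s) = b) = ∅
      · rw [hne, empty_union] at hbad
        exact b₂ i' hi' b hbad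
      · obtain ⟨s, hs⟩ := nonempty_iff_ne_empty.2 hne
        rw [mem_filter] at hs
        have : (G.filter fun s => I.L i' (π₂ s) = b) = ∅ := by
          refine filter_eq_empty_iff.2 fun s' hs' h => ?_
          exact sep i' hi' _ (o₁ s hs.1).1 _ (o₂ s' hs').1 (hs.2.trans h.symm)
        rw [this, union_empty] at hbad
        exact b₁ i' hi' b hbad
    · rw [e, e₁, e₂, code_union hFG, code_congr hπF, code_congr hπG]
      omega

/-- All users of `X` carry the same label on level `i`, so the only label class of `F` on that level
that can be nonempty is `F` itself. The new condition is just that `F` is not bad. -/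
theorem Rep.filter (h : I.Rep i X T) {b : ℕ} (hX : ∀ x ∈ X, I.L i x = b)
    (hT : ∀ F ⊆ range I.k, I.Bad i F ∧ T₁ (mask F) = 0 ∨ ¬ I.Bad i F ∧ T₁ (mask F) = T (mask F)) :
    I.Rep (i + 1) X T₁ := by
  have key : ∀ F π, I.Ok (i + 1) X F π ↔ I.Ok i X F π ∧ ¬ I.Bad i F := by
    intro F π
    constructor
    · rintro ⟨h1, h2⟩
      refine ⟨⟨h1, fun i' hi' => h2 i' (by omega)⟩, ?_⟩
      have := h2 i (by omega) b
      rwa [filter_true_of_mem fun s hs => hX _ (h1 s hs).1] at this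
    · rintro ⟨⟨h1, h2⟩, h3⟩
      refine ⟨h1, fun i' hi' b' => ?_⟩
      rcases Nat.lt_succ_iff_lt_or_eq.1 hi' with hi' | rfl
      · exact h2 i' hi' b'
      · intro hbad
        obtain ⟨s, hs⟩ := hbad.1
        rw [mem_filter] at hs
        have hb : b' = b := hs.2.symm.trans (hX _ (h1 s hs.1).1)
        subst hb
        rw [filter_true_of_mem fun s hs => hX _ (h1 s hs).1] at hbad
        exact h3 hbad
  intro F hF
  rcases hT F hF with ⟨hb, h0⟩ | ⟨hb, h0⟩
  · exact .inl ⟨h0, fun ⟨π, hπ⟩ => ((key F π).1 hπ).2 hb⟩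
  · rw [h0]
    rcases h F hF with ⟨h1, h2⟩ | ⟨π, h1, h2⟩
    · exact .inl ⟨h1, fun ⟨π, hπ⟩ => h2 ⟨π, ((key F π).1 hπ).1⟩⟩
    · exact .inr ⟨π, (key F π).2 ⟨h1, hb⟩, h2⟩

/-- Without users only the empty plan remains; its code `0` is stored as `1`. It is admissible at
every level because bad sets are nonempty by definition. -/
theorem rep_empty (i : ℕ) (hT : ∀ x < 2 ^ I.k, T x = if x = 0 then 1 else 0) :
    I.Rep i ∅ T := by
  intro F hF
  rw [hT _ (mask_lt hF)]
  rcases F.eq_empty_or_nonempty with rfl | ⟨s, hs⟩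
  · exact .inr ⟨fun _ => 0, ⟨by simp, fun i' _ b hb => by simpa using hb.1⟩, by simp [mask, code]⟩
  · have : mask F ≠ 0 := fun h => by simp [mask_eq_zero.1 h] at hs
    exact .inl ⟨if_neg this, fun ⟨π, hπ⟩ => (hπ.1 s hs).1⟩

theorem rep_singleton (u : ℕ) (hT : ∀ F ⊆ range I.k, (∀ s ∈ F, I.au s u ≠ 0) ∧
      T (mask F) = code I.n (fun _ => u) F + 1 ∨ ¬ (∀ s ∈ F, I.au s u ≠ 0) ∧ T (mask F) = 0) :
    I.Rep 0 {u} T := by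
  intro F hF
  rcases hT F hF with ⟨h, h0⟩ | ⟨h, h0⟩
  · exact .inr ⟨fun _ => u, ⟨fun s hs => ⟨rfl, h s hs⟩, by simp⟩, h0⟩
  · refine .inl ⟨h0, fun ⟨π, hπ⟩ => h fun s hs => ?_⟩
    have := hπ.1 s hs
    rw [Set.mem_singleton_iff] at this
    rw [← this.1]
    exact this.2

end Inst

/-! ## The program: preparation of the tables -/

/-- The cells of the input arrays hold the instance `I`. -/
structure Input (I : Inst) (m : Mem) : Prop where
  n : m 0 0 = I.n
  k : m 0 1 = I.k
  c : m 0 2 = I.c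
  ℓ : m 0 3 = I.ℓ
  au : ∀ s u, m 2 (I.n * s + u) = I.au s u
  sg : ∀ j, m 3 j = I.sg j
  ix : ∀ j, m 4 j = I.ix j
  s₁ : ∀ j s, m 5 (I.k * j + s) = I.s₁ j s
  s₂ : ∀ j s, m 6 (I.k * j + s) = I.s₂ j s
  L : ∀ i u, m 7 (I.n * i + u) = I.L i u

theorem Input.of_agreeOff {I : Inst} {l : List ℕ} {m m' : Mem} (h : Input I m)
    (hm : AgreeOff l m m') (hl : ∀ a < 8, a ∉ l) : Input I m' := by
  obtain ⟨h1, h2, h3, h4, h5, h6, h7, h8, h9, h10⟩ := h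
  constructor
  all_goals (first
    | rw [hm 0 (hl 0 (by simp))] | rw [hm 2 (hl 2 (by simp))] | rw [hm 3 (hl 3 (by simp))]
    | rw [hm 4 (hl 4 (by simp))] | rw [hm 5 (hl 5 (by simp))] | rw [hm 6 (hl 6 (by simp))]
    | rw [hm 7 (hl 7 (by simp))])
  all_goals assumption

/-- Bits are bits, and the numbers handled by the program fit into words of length `w`. -/
structure Fits (I : Inst) (w : ℕ) : Prop where
  n_pos : 0 < I.n
  au_le : ∀ s u, I.au s u ≤ 1
  s₁_le : ∀ j s, I.s₁ j s ≤ 1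
  s₂_le : ∀ j s, I.s₂ j s ≤ 1
  n_pow : I.n ^ I.k < 2 ^ w
  three_pow : 3 ^ I.k < 2 ^ w
  c : I.c < 2 ^ w
  tables : I.ℓ * I.n + I.n < 2 ^ w

theorem Fits.k {I : Inst} {w : ℕ} (h : Fits I w) : I.k < 2 ^ w :=
  (Nat.lt_pow_self (by simp : 1 < 3)).trans h.three_pow

theorem Fits.two_pow {I : Inst} {w : ℕ} (h : Fits I w) : 2 ^ I.k < 2 ^ w :=
  (Nat.pow_le_pow_left (by simp) _).trans_lt h.three_pow

theorem Fits.n {I : Inst} {w : ℕ} (h : Fits I w) : I.n < 2 ^ w :=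
  (Nat.le_add_left _ _).trans_lt h.tables

/-- Used to see that cells of different rows of a table stored row by row never collide. -/
theorem pair_inj {q a b x y : ℕ} (hx : x < q) (hy : y < q) :
    a * q + x = b * q + y ↔ a = b ∧ x = y := by
  constructor
  · intro h
    have h1 : (a * q + x) / q = a := by
      rw [mul_comm, Nat.mul_add_div (by omega), Nat.div_eq_of_lt hx, add_zero]
    have h2 : (b * q + y) / q = b := by
      rw [mul_comm, Nat.mul_add_div (by omega), Nat.div_eq_of_lt hy, add_zero]
    have : a = b := by rw [← h1, h, h2]
    subst this
    exact ⟨rfl, by omega⟩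
  · rintro ⟨rfl, rfl⟩
    rfl

/-- The number of steps. -/
def stepsExp : Exp := .read 0 1

/-- The number of sets of steps, available after `powersCmd`. -/
def masksExp : Exp := .read 9 stepsExp

/-- Powers of `2`, `n` and `3` in the arrays `9`, `10` and `11`. -/
def powersCmd : Cmd :=
  .seq (.store 9 0 1) (.seq (.store 10 0 1) (.seq (.store 11 0 1)
    (.forLoop 23 stepsExp
      (.seq (.store 9 (.var 23 + 1) (2 * .read 9 (.var 23)))
      (.seq (.store 10 (.var 23 + 1) (.var 0 * .read 10 (.var 23)))
        (.store 11 (.var 23 + 1) (3 * .read 11 (.var 23))))))))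

/-- The arrays `9`, `10` and `11` hold the powers of `2`, `n` and `3`. -/
def Powers (I : Inst) (m : Mem) : Prop :=
  ∀ s ≤ I.k, m 9 s = 2 ^ s ∧ m 10 s = I.n ^ s ∧ m 11 s = 3 ^ s

theorem powersCmd_does {I : Inst} {w : ℕ} {m : Mem} (hI : Input I m) (hw : Fits I w) :
    Does w powersCmd (200 * (I.k + 1)) m (Powers I) := by
  have h1 : 1 < 2 ^ w := (Nat.one_le_pow _ _ (by simp)).trans_lt hw.three_pow
  refine .mono (.seq (.store h1 fun _ => .seq (.store h1 fun _ => .seq (.store h1 fun _ =>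
      Does.forLoop (cb := 100) (C := 150) I.k (by decide)
        (fun j m' => ∀ s ≤ j, m' 9 s = 2 ^ s ∧ m' 10 s = I.n ^ s ∧ m' 11 s = 3 ^ s)
        hw.k (by decide) ?_ ?_ ?_ ?_)))) ?_
  · intro m' hm'
    simp [stepsExp, hm' 0 (by decide), write_of_ne, hI.k]
  · simp [write_of_ne]
  · intro j m' hj hf hv ih
    have h0 : m' 0 0 = I.n := by
      rw [hf 0 (by decide)]; simp [write_of_ne, hI.n]
    obtain ⟨i1, i2, i3⟩ := ih j le_rfl
    have b1 : 2 ^ (j + 1) < 2 ^ w :=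
      (Nat.pow_le_pow_right (by simp) (by omega)).trans_lt hw.two_pow
    have b2 : I.n ^ (j + 1) < 2 ^ w :=
      (Nat.pow_le_pow_right hw.n_pos (by omega)).trans_lt hw.n_pow
    have b3 : 3 ^ (j + 1) < 2 ^ w :=
      (Nat.pow_le_pow_right (by simp) (by omega)).trans_lt hw.three_pow
    rw [pow_succ'] at b1 b2 b3
    refine .mono (.seq (.store (by simpa [hv, i1] using b1) fun _ =>
      .seq (.store (by simpa [hv, h0, i2, write_of_ne] using b2) fun _ =>
        (.store (by simpa [hv, i3, write_of_ne] using b3) fun _ s hs => ?_)))) (by decide)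
    simp only [Exp.eval_add, Exp.eval_mul, Exp.eval_var, Exp.eval_read, Exp.eval_one, Exp.eval_two,
      Exp.eval_three, write_apply, hv, h0, i1, i2, i3, ne_eq, Nat.reduceEqDiff,
      not_false_eq_true, write_of_ne, OfNat.zero_ne_ofNat]
    rcases Nat.lt_succ_iff_lt_or_eq.1 (Nat.lt_succ_of_le hs) with h | rfl
    · simp [show s ≠ j + 1 by omega, ih s (by omega)]
    · simp [pow_succ']
  · intro m' _ h
    exact h
  · have e : (1 : Exp).weight = 2 ∧ (1 : Exp).width = 1 ∧ (0 : Exp).weight = 1 ∧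
        (0 : Exp).width = 0 := by decide
    obtain ⟨e1, e2, e3, e4⟩ := e
    rw [e1, e2, e3, e4]
    omega

/-- The arrays `12` and `13` hold the pairs of disjoint sets of steps. -/
def ternaryCmd : Cmd :=
  .forLoop 22 (.read 11 stepsExp)
    (.seq (.store 12 (.var 22) (2 * .read 12 (.var 22 / 3) +
      (.var 22 - 3 * (.var 22 / 3)) * (2 - (.var 22 - 3 * (.var 22 / 3)))))
    (.store 13 (.var 22) (2 * .read 13 (.var 22 / 3) + (.var 22 - 3 * (.var 22 / 3)) / 2)))

theorem recode₁_step (t : ℕ) :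
    recode₁ t = 2 * recode₁ (t / 3) + (t - 3 * (t / 3)) * (2 - (t - 3 * (t / 3))) := by
  rw [recode₁, recode_eq (by simp), show t - 3 * (t / 3) = t % 3 by omega]

theorem recode₂_step (t : ℕ) :
    recode₂ t = 2 * recode₂ (t / 3) + (t - 3 * (t / 3)) / 2 := by
  rw [recode₂, recode_eq (by simp), show t - 3 * (t / 3) = t % 3 by omega]

theorem recode_lt {k t : ℕ} (ht : t < 3 ^ k) : recode₁ t < 2 ^ k ∧ recode₂ t < 2 ^ k := by
  obtain ⟨F, G, hF, hG, -, h1, h2⟩ := exists_disjoint_of_lt ht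
  exact ⟨h1 ▸ mask_lt hF, h2 ▸ mask_lt hG⟩

theorem ternaryCmd_does {I : Inst} {w : ℕ} {m : Mem} (hI : Input I m) (hw : Fits I w)
    (hp : Powers I m) (h12 : ∀ t, m 12 t = 0) (h13 : ∀ t, m 13 t = 0) :
    Does w ternaryCmd ((3 ^ I.k + 1) * 700) m fun m' =>
      ∀ t < 3 ^ I.k, m' 12 t = recode₁ t ∧ m' 13 t = recode₂ t := by
  refine Does.forLoop (cb := 600) (3 ^ I.k) (by decide)
    (fun j m' => ∀ t, m' 12 t = (if t < j then recode₁ t else 0) ∧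
      m' 13 t = if t < j then recode₂ t else 0)
    hw.three_pow (by decide) ?_ ?_ ?_ ?_
  · intro m' hm'
    simp [stepsExp, hm' 0 (by decide), hm' 11 (by decide), hI.k, (hp I.k le_rfl).2.2]
  · simp [write_of_ne, h12, h13]
  · intro j m' hj hf hv ih
    -- For `j = 0` the cell read is the one about to be written; its initial content `0` is already
    -- the right value.
    have r1 : m' 12 (j / 3) = recode₁ (j / 3) := by
      rw [(ih _).1]
      rcases Nat.eq_zero_or_pos j with rfl | h0
      · simp [recode₁, recode_zero]
      · rw [if_pos (Nat.div_lt_self h0 (by simp))]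
    have r2 : m' 13 (j / 3) = recode₂ (j / 3) := by
      rw [(ih _).2]
      rcases Nat.eq_zero_or_pos j with rfl | h0
      · simp [recode₂, recode_zero]
      · rw [if_pos (Nat.div_lt_self h0 (by simp))]
    obtain ⟨l1, l2⟩ := recode_lt hj
    have b1 := l1.trans hw.two_pow
    have b2 := l2.trans hw.two_pow
    refine .mono (.seq (.store ?_ fun _ => .store ?_ fun _ t => ?_)) (by decide)
    · simpa [hv, r1, ← recode₁_step] using b1
    · simpa [hv, r2, write_of_ne, ← recode₂_step] using b2
    · simp only [Exp.eval_add, Exp.eval_sub, Exp.eval_div, Exp.eval_mul, Exp.eval_var, Exp.eval_read,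
        Exp.eval_two, Exp.eval_three, write_apply, hv, r1, r2, ne_eq, Nat.reduceEqDiff,
        not_false_eq_true, write_of_ne, ← recode₁_step, ← recode₂_step, ih t]
      rcases lt_trichotomy t j with h | rfl | h
      · simp [h, h.ne, Nat.lt_succ_of_lt h]
      · simp
      · simp [h.ne', not_lt.2 h.le, not_lt.2 (Nat.succ_le_of_lt h)]
  · intro m' _ h t ht
    simpa [ht] using h t

/-! ### Bad sets of steps -/

/-- One if the step `23` belongs to the set `22` and zero otherwise. -/
def bitExp : Exp :=
  .var 22 / .read 9 (.var 23) - 2 * (.var 22 / .read 9 (.var 23) / 2)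

/-- How many steps of the two sets of the constraint `20` belong and do not belong to the set
`22`. -/
def countCmd : Cmd :=
  .seq (.store 24 0 0) (.seq (.store 25 0 0) (.seq (.store 26 0 0) (.seq (.store 27 0 0)
    (.forLoop 23 stepsExp
      (.seq (.store 24 0 (.var 24 + bitExp * .read 5 (stepsExp * .var 20 + .var 23)))
      (.seq (.store 25 0 (.var 25 + (1 - bitExp) * .read 5 (stepsExp * .var 20 + .var 23)))
      (.seq (.store 26 0 (.var 26 + bitExp * .read 6 (stepsExp * .var 20 + .var 23)))
        (.store 27 0 (.var 27 + (1 - bitExp) * .read 6 (stepsExp * .var 20 + .var 23))))))))))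

/-- The number of elements of `F` below `k`, weighted by `f`. -/
def countIn (F : Finset ℕ) (f : ℕ → ℕ) (k : ℕ) : ℕ := ∑ s ∈ range k, (if s ∈ F then 1 else 0) * f s

/-- The number of elements below `k` of the complement of `F`, weighted by `f`. -/
def countOut (F : Finset ℕ) (f : ℕ → ℕ) (k : ℕ) : ℕ :=
  ∑ s ∈ range k, (1 - if s ∈ F then 1 else 0) * f s

theorem countIn_le (F : Finset ℕ) {f : ℕ → ℕ} (hf : ∀ s, f s ≤ 1) (k : ℕ) : countIn F f k ≤ k := by
  refine (sum_le_card_nsmul _ _ 1 fun s _ => ?_).trans (by simp)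
  have := hf s
  split_ifs <;> omega

theorem countOut_le (F : Finset ℕ) {f : ℕ → ℕ} (hf : ∀ s, f s ≤ 1) (k : ℕ) :
    countOut F f k ≤ k := by
  refine (sum_le_card_nsmul _ _ 1 fun s _ => ?_).trans (by simp)
  have := hf s
  split_ifs <;> omega

theorem countIn_eq_zero {F : Finset ℕ} {f : ℕ → ℕ} {k : ℕ} :
    countIn F f k = 0 ↔ ∀ s < k, f s ≠ 0 → s ∉ F := by
  rw [countIn, sum_eq_zero_iff]
  refine forall_congr' fun s => ?_
  rw [mem_range]
  split_ifs with h <;> simp [h]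

theorem countOut_eq_zero {F : Finset ℕ} {f : ℕ → ℕ} {k : ℕ} :
    countOut F f k = 0 ↔ ∀ s < k, f s ≠ 0 → s ∈ F := by
  rw [countOut, sum_eq_zero_iff]
  refine forall_congr' fun s => ?_
  rw [mem_range]
  split_ifs with h <;> simp [h]

theorem eval_bitExp {I : Inst} {m : Mem} {F : Finset ℕ} (hp : Powers I m) (hF : m 22 0 = mask F)
    (hs : m 23 0 ≤ I.k) : bitExp.eval m = if m 23 0 ∈ F then 1 else 0 := by
  rw [← mask_div_two_pow]
  simp only [bitExp, Exp.eval_sub, Exp.eval_div, Exp.eval_mul, Exp.eval_var, Exp.eval_read,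
    Exp.eval_two, hF, (hp _ hs).1]
  omega

theorem bitExp_eval_write {m : Mem} {a i v : ℕ} (ha : 23 < a) :
    bitExp.eval (m.write a i v) = bitExp.eval m := by
  simp [bitExp, write_of_ne, show 22 ≠ a by omega, show 9 ≠ a by omega, show 23 ≠ a by omega]

theorem Powers.of_agreeOff {I : Inst} {l : List ℕ} {m m' : Mem} (h : Powers I m)
    (hm : AgreeOff l m m') (h9 : 9 ∉ l) (h10 : 10 ∉ l) (h11 : 11 ∉ l) : Powers I m' := by
  intro s hs
  rw [hm 9 h9, hm 10 h10, hm 11 h11]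
  exact h s hs

theorem countCmd_does {I : Inst} {w j : ℕ} {F : Finset ℕ} {m : Mem} (hI : Input I m)
    (hw : Fits I w) (hp : Powers I m) (hj : m 20 0 = j) (hF : m 22 0 = mask F) :
    Does w countCmd ((I.k + 1) * 1150) m fun m' =>
      m' 24 0 = countIn F (I.s₁ j) I.k ∧ m' 25 0 = countOut F (I.s₁ j) I.k ∧
      m' 26 0 = countIn F (I.s₂ j) I.k ∧ m' 27 0 = countOut F (I.s₂ j) I.k := by
  have h0 : 0 < 2 ^ w := by positivity
  refine .mono (.seq (.store h0 fun _ => .seq (.store h0 fun _ => .seq (.store h0 fun _ =>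
    .seq (.store h0 fun _ => Does.forLoop (cb := 1000) (C := 1100) I.k (by decide)
        (fun s m' => m' 24 0 = countIn F (I.s₁ j) s ∧ m' 25 0 = countOut F (I.s₁ j) s ∧
          m' 26 0 = countIn F (I.s₂ j) s ∧ m' 27 0 = countOut F (I.s₂ j) s)
        hw.k (by decide) ?_ ?_ ?_ ?_))))) ?_
  · intro m' hm'
    simp [stepsExp, hm' 0 (by decide), write_of_ne, hI.k]
  · simp [write_of_ne, countIn, countOut]
  · intro s m' hs hf hv ⟨i1, i2, i3, i4⟩
    have hf0 : AgreeOff [23, 24, 25, 26, 27] m m' := by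
      intro a ha
      rw [hf a (by simpa [Cmd.mods] using ha)]
      simp only [List.mem_cons, not_or] at ha
      simp [write_of_ne, ha]
    have hI' := hI.of_agreeOff hf0 (by decide)
    have hp' := hp.of_agreeOff hf0 (by decide) (by decide) (by decide)
    have hj' : m' 20 0 = j := by rw [hf0 20 (by decide), hj]
    have hb := eval_bitExp hp' (by rw [hf0 22 (by decide), hF]) (by omega)
    have hk := hI'.k
    have e1 := hI'.s₁ j s
    have e2 := hI'.s₂ j s
    rw [hv] at hb
    have c1 := (countIn_le F (hw.s₁_le j) (s + 1)).trans_lt (by have := hw.k; omega : s + 1 < 2 ^ w)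
    have c2 := (countOut_le F (hw.s₁_le j) (s + 1)).trans_lt (by have := hw.k; omega : s + 1 < 2 ^ w)
    have c3 := (countIn_le F (hw.s₂_le j) (s + 1)).trans_lt (by have := hw.k; omega : s + 1 < 2 ^ w)
    have c4 := (countOut_le F (hw.s₂_le j) (s + 1)).trans_lt (by have := hw.k; omega : s + 1 < 2 ^ w)
    simp only [countIn, countOut, sum_range_succ] at c1 c2 c3 c4 i1 i2 i3 i4 ⊢
    refine .mono (.seq (.store ?_ fun _ => .seq (.store ?_ fun _ => .seq (.store ?_ fun _ =>
      .store ?_ fun _ => ?_)))) (by decide)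
    · simpa [stepsExp, hv, hk, hj', i1, hb, e1] using c1
    · simpa [stepsExp, bitExp_eval_write, write_of_ne, hv, hk, hj', i2, hb, e1] using c2
    · simpa [stepsExp, bitExp_eval_write, write_of_ne, hv, hk, hj', i3, hb, e2] using c3
    · simpa [stepsExp, bitExp_eval_write, write_of_ne, hv, hk, hj', i4, hb, e2] using c4
    · simp [stepsExp, bitExp_eval_write, write_of_ne, hv, hk, hj', i1, i2, i3, i4, hb, e1, e2]
  · intro m' _ h
    exact h
  · have e : (0 : Exp).weight = 1 ∧ (0 : Exp).width = 0 := by decide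
    rw [e.1, e.2]
    omega

/-- Inclusion and disjointness are the vanishing of counts. In the natural numbers a sum vanishes
iff both terms do and a product iff one factor does, so for each kind of constraint a single
arithmetic test decides violation. -/
theorem Inst.viol_iff {I : Inst} {j : ℕ} {F : Finset ℕ} : I.Viol j F ↔
    (I.sg j ≠ 0 ∧ countOut F (I.s₁ j) I.k + countOut F (I.s₂ j) I.k = 0) ∨
    (I.sg j = 0 ∧ (countOut F (I.s₁ j) I.k + countIn F (I.s₂ j) I.k) *
      (countOut F (I.s₂ j) I.k + countIn F (I.s₁ j) I.k) = 0) := by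
  rw [mul_eq_zero, add_eq_zero, add_eq_zero, add_eq_zero]
  simp only [countIn_eq_zero, countOut_eq_zero]
  rfl

/-- Marks the set `22` as bad at the level of the constraint `20`. -/
def markCmd : Cmd := .store 14 (.read 4 (.var 20) * masksExp + .var 22) 1

/-- Marks the set `22` if it violates the constraint `20`. -/
def testCmd : Cmd :=
  .seq countCmd (.ite (.var 22) (.ite (.read 3 (.var 20)) (.ite (.var 25 + .var 27) .skip markCmd)
    (.ite ((.var 25 + .var 26) * (.var 27 + .var 24)) .skip markCmd)) .skip)

open Classical in
theorem testCmd_does {I : Inst} {w j : ℕ} {F : Finset ℕ} {m : Mem} (hI : Input I m)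
    (hw : Fits I w) (hp : Powers I m) (hj : m 20 0 = j) (hF : m 22 0 = mask F) :
    Does w testCmd ((I.k + 1) * 1300) m fun m' =>
      ∀ a, m' 14 a = if a = I.ix j * 2 ^ I.k + mask F ∧ F.Nonempty ∧ I.Viol j F then 1
        else m 14 a := by
  refine .mono (.seq (N₂ := 150) (.imp (countCmd_does hI hw hp hj hF) ?_)) (by omega)
  intro m' hm' ⟨c1, c2, c3, c4⟩ _
  have hI' := hI.of_agreeOff hm' (by decide)
  have hj' : m' 20 0 = j := by rw [hm' 20 (by decide), hj]
  have hF' : m' 22 0 = mask F := by rw [hm' 22 (by decide), hF]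
  have h14 : m' 14 = m 14 := hm' 14 (by decide)
  have hp' := hp.of_agreeOff hm' (by decide) (by decide) (by decide)
  have h1 : 1 < 2 ^ w := (Nat.one_le_pow _ _ (by simp)).trans_lt hw.three_pow
  have mark : Does w markCmd 50 m' fun m'' => ∀ a, m'' 14 a =
      if a = I.ix j * 2 ^ I.k + mask F then 1 else m 14 a := by
    refine .mono (.store h1 fun a => ?_) (by decide)
    simp [write_apply, masksExp, stepsExp, hj', hF', hI'.ix, hI'.k, (hp' I.k le_rfl).1, h14]
  have none : ∀ {Q : Mem → Prop}, Q m' → Does w .skip 50 m' Q := fun h =>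
    (Does.skip h).mono (by simp)
  have hsg := hI'.sg j
  refine .mono (.ite (N := 130) (fun h22 => ?_) fun h22 => ?_) (by decide)
  · have hne : F.Nonempty := by
      rw [nonempty_iff_ne_empty, Ne, ← mask_eq_zero, ← hF']
      exact h22
    refine .mono (.ite (N := 100) (fun h3 => ?_) fun h3 => ?_) (by decide)
    · simp only [Exp.eval_read, Exp.eval_var, hj', hsg] at h3
      refine .mono (.ite (N := 50) (fun h => ?_) fun h => ?_) (by decide)
      · simp only [Exp.eval_add, Exp.eval_var, c2, c4] at h
        refine none fun a => ?_
        rw [if_neg, h14]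
        rintro ⟨-, -, hv⟩
        rw [Inst.viol_iff] at hv
        tauto
      · simp only [Exp.eval_add, Exp.eval_var, c2, c4] at h
        have hv : I.Viol j F := Inst.viol_iff.2 (.inl ⟨h3, h⟩)
        simpa [hv, hne] using mark
    · simp only [Exp.eval_read, Exp.eval_var, hj', hsg] at h3
      refine .mono (.ite (N := 50) (fun h => ?_) fun h => ?_) (by decide)
      · simp only [Exp.eval_add, Exp.eval_mul, Exp.eval_var, c1, c2, c3, c4] at h
        refine none fun a => ?_
        rw [if_neg, h14]
        rintro ⟨-, -, hv⟩
        rw [Inst.viol_iff] at hv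
        tauto
      · simp only [Exp.eval_add, Exp.eval_mul, Exp.eval_var, c1, c2, c3, c4] at h
        have hv : I.Viol j F := Inst.viol_iff.2 (.inr ⟨h3, h⟩)
        simpa [hv, hne] using mark
  · refine (none fun a => ?_).mono (by simp)
    rw [if_neg, h14]
    rintro ⟨-, ⟨s, hs⟩, -⟩
    rw [Exp.eval_var, hF', mask_eq_zero] at h22
    simp [h22] at hs

/-- Marks in the array `14` the sets that violate a constraint, for every level. -/
def badCmd : Cmd := .forLoop 20 (.read 0 2) (.forLoop 22 masksExp testCmd)

/-- `F` violates one of the first `j` constraints, or the `j`-th one and has a code less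
than `x`. -/
def Inst.BadBelow (I : Inst) (j x i : ℕ) (F : Finset ℕ) : Prop :=
  F.Nonempty ∧ ((∃ j' < j, I.ix j' = i ∧ I.Viol j' F) ∨ (mask F < x ∧ I.ix j = i ∧ I.Viol j F))

theorem Inst.badBelow_succ {I : Inst} {j x i : ℕ} {F : Finset ℕ} : I.BadBelow j (x + 1) i F ↔
    ((i = I.ix j ∧ mask F = x) ∧ F.Nonempty ∧ I.Viol j F) ∨ I.BadBelow j x i F := by
  rw [Inst.BadBelow, Inst.BadBelow, Order.lt_add_one_iff, le_iff_lt_or_eq, eq_comm (a := i)]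
  generalize (∃ j' < j, I.ix j' = i ∧ I.Viol j' F) = p
  tauto

/-- Every set of steps has a code below `2 ^ k`, so the end of the inner loop for one constraint is
the start of the next constraint. -/
theorem Inst.badBelow_two_pow {I : Inst} {j i : ℕ} {F : Finset ℕ} (hF : F ⊆ range I.k) :
    I.BadBelow j (2 ^ I.k) i F ↔ I.BadBelow (j + 1) 0 i F := by
  simp only [Inst.BadBelow, mask_lt hF, Nat.not_lt_zero, true_and, false_and, or_false,
    Order.lt_add_one_iff, le_iff_lt_or_eq, or_and_right, exists_or, exists_eq_left]

open Classical in
theorem badCmd_does {I : Inst} {w : ℕ} {m : Mem} (hI : Input I m) (hw : Fits I w)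
    (hp : Powers I m) (h14 : ∀ a, m 14 a = 0) :
    Does w badCmd ((I.c + 1) * ((2 ^ I.k + 2) * ((I.k + 1) * 1400))) m fun m' =>
      ∀ i, ∀ F ⊆ range I.k, m' 14 (i * 2 ^ I.k + mask F) = if I.Bad i F then 1 else 0 := by
  refine Does.forLoop (cb := (2 ^ I.k + 1) * ((I.k + 1) * 1400)) I.c ?_ (fun j m' =>
    ∀ i, ∀ F ⊆ range I.k, m' 14 (i * 2 ^ I.k + mask F) = if I.BadBelow j 0 i F then 1 else 0)
    hw.c (by decide) ?_ ?_ ?_ ?_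
  · have : (Exp.read 0 2).weight + (Exp.read 0 2).width + 40 ≤ 1400 := by decide
    nlinarith
  · intro m' hm'
    simp [hm' 0 (by decide), hI.c]
  · simp [write_of_ne, h14, Inst.BadBelow]
  · intro j m₁ hj hf₁ hv₁ ih₁
    have hI₁ := hI.of_agreeOff hf₁ (by decide)
    have hp₁ := hp.of_agreeOff hf₁ (by decide) (by decide) (by decide)
    refine Does.forLoop (cb := (I.k + 1) * 1300) (2 ^ I.k) ?_ (fun x m' =>
      ∀ i, ∀ F ⊆ range I.k, m' 14 (i * 2 ^ I.k + mask F) = if I.BadBelow j x i F then 1 else 0)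
      hw.two_pow (by decide) ?_ ?_ ?_ ?_
    · have : masksExp.weight + masksExp.width + 40 ≤ 100 := by decide
      nlinarith
    · intro m' hm'
      simp [masksExp, stepsExp, hm' 0 (by decide), hm' 9 (by decide), hI₁.k, (hp₁ I.k le_rfl).1]
    · simpa [write_of_ne] using ih₁
    · intro x m₂ hx hf₂ hv₂ ih₂
      obtain ⟨F, hF, rfl⟩ := exists_mask_eq hx
      refine (testCmd_does (hI₁.of_agreeOff hf₂ (by decide)) hw
        (hp₁.of_agreeOff hf₂ (by decide) (by decide) (by decide))
        (by rw [hf₂ 20 (by decide), hv₁]) hv₂).imp fun m₃ _ h₃ _ i G hG => ?_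
      rw [write_of_ne (by simp), h₃, ih₂ i G hG]
      simp only [pair_inj (mask_lt hG) (mask_lt hF)]
      rw [Inst.badBelow_succ]
      by_cases h : mask G = mask F
      · rw [mask_inj h]
        by_cases hv : (i = I.ix j ∧ mask F = mask F) ∧ F.Nonempty ∧ I.Viol j F
        · rw [if_pos hv, if_pos (.inl hv)]
        · rw [if_neg hv]
          by_cases hB : I.BadBelow j (mask F) i F
          · rw [if_pos hB, if_pos (.inr hB)]
          · rw [if_neg hB, if_neg (not_or.2 ⟨hv, hB⟩)]
      · rw [if_neg fun h' => h h'.1.2]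
        congr 1
        simp only [h, and_false, false_and, false_or]
    · intro m' _ h _ i F hF
      rw [write_of_ne (by simp), h i F hF]
      simp only [Inst.badBelow_two_pow hF]
  · intro m' _ h i F hF
    rw [h i F hF]
    congr 1
    simp [Inst.BadBelow, Inst.Bad]

/-! ### The tables of single users -/

/-- Writes the cell of the set `22` in the table of the user `21`. -/
def userCellCmd : Cmd :=
  .seq (.store 24 0 0) (.seq (.store 25 0 0) (.seq
    (.forLoop 23 stepsExp
      (.seq (.store 24 0 (.var 24 + bitExp * (.var 21 * .read 10 (.var 23))))
        (.store 25 0 (.var 25 + bitExp * (1 - .read 2 (.var 0 * .var 23 + .var 21))))))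
    (.store 15 ((.var 21 + 1) * masksExp + .var 22) ((1 + .var 24) * (1 - .var 25)))))

/-- The weighted count accumulated by the loop over the steps is the code of the constant plan. -/
theorem countIn_eq_code {F : Finset ℕ} {n u k : ℕ} (hF : F ⊆ range k) :
    countIn F (fun s => u * n ^ s) k = code n (fun _ => u) F := by
  rw [countIn, code, ← sum_subset hF]
  · exact sum_congr rfl fun s hs => by simp [hs]
  · intro s _ hs
    simp [hs]

theorem countIn_mono {F : Finset ℕ} {f : ℕ → ℕ} {j k : ℕ} (h : j ≤ k) :
    countIn F f j ≤ countIn F f k :=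
  sum_le_sum_of_subset (range_subset_range.2 h)

open Classical in
/-- The contents of the table of the user `u`. -/
noncomputable def Inst.userCell (I : Inst) (u : ℕ) (F : Finset ℕ) : ℕ :=
  if ∀ s ∈ F, I.au s u ≠ 0 then code I.n (fun _ => u) F + 1 else 0

theorem userCellCmd_does {I : Inst} {w u : ℕ} {F : Finset ℕ} {m : Mem} (hI : Input I m)
    (hw : Fits I w) (hp : Powers I m) (hu : m 21 0 = u) (hun : u < I.n) (hF : m 22 0 = mask F)
    (hFk : F ⊆ range I.k) :
    Does w userCellCmd ((I.k + 1) * 900) m fun m' =>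
      ∀ a, m' 15 a = if a = (u + 1) * 2 ^ I.k + mask F then I.userCell u F else m 15 a := by
  have h0 : 0 < 2 ^ w := by positivity
  have hcode := code_lt (n := I.n) (π := fun _ => u) hFk hw.n_pos (fun s _ => hun)
  have hcode' := countIn_eq_code (n := I.n) (u := u) hFk
  refine .mono (.seq (.store h0 fun _ => .seq (.store h0 fun _ => .seq (N₂ := 150)
    (Does.forLoop (cb := 550) (C := 650) I.k (by decide)
        (fun s m' => m' 24 0 = countIn F (fun s => u * I.n ^ s) s ∧
          m' 25 0 = countIn F (fun s => 1 - I.au s u) s)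
        hw.k (by decide) ?_ ?_ ?_ ?_)))) ?_
  · intro m' hm'
    simp [stepsExp, hm' 0 (by decide), write_of_ne, hI.k]
  · simp [write_of_ne, countIn]
  · intro s m' hs hf hv ⟨i1, i2⟩
    have hf0 : AgreeOff [23, 24, 25] m m' := by
      intro a ha
      rw [hf a (by simpa [Cmd.mods] using ha)]
      simp only [List.mem_cons, not_or] at ha
      simp [write_of_ne, ha]
    have hI' := hI.of_agreeOff hf0 (by decide)
    have hp' := hp.of_agreeOff hf0 (by decide) (by decide) (by decide)
    have hu' : m' 21 0 = u := by rw [hf0 21 (by decide), hu]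
    have hb := eval_bitExp hp' (by rw [hf0 22 (by decide), hF]) (by omega)
    have hn := hI'.n
    have e1 := hI'.au s u
    have e2 := (hp' s hs.le).2.1
    rw [hv] at hb
    have c1 : countIn F (fun s => u * I.n ^ s) (s + 1) < 2 ^ w :=
      (countIn_mono hs).trans_lt (by rw [hcode']; exact hcode.trans hw.n_pow)
    have c2 : countIn F (fun s => 1 - I.au s u) (s + 1) < 2 ^ w :=
      (countIn_le F (fun s => Nat.sub_le _ _) (s + 1)).trans_lt
        (by have := hw.k; omega : s + 1 < 2 ^ w)
    simp only [countIn, sum_range_succ] at c1 c2 i1 i2 ⊢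
    refine .mono (.seq (.store ?_ fun _ => .store ?_ fun _ => ?_)) (by decide)
    · simpa [hv, hu', i1, hb, e2] using c1
    · simpa [bitExp_eval_write, write_of_ne, hv, hn, hu', i2, hb, e1] using c2
    · simp [bitExp_eval_write, write_of_ne, hv, hn, hu', i1, i2, hb, e1, e2]
  · intro m' hf ⟨i1, i2⟩ _
    have hf0 : AgreeOff [23, 24, 25] m m' := by
      intro a ha
      rw [hf a (by simpa [Cmd.mods] using ha)]
      simp only [List.mem_cons, not_or] at ha
      simp [write_of_ne, ha]
    have hI' := hI.of_agreeOff hf0 (by decide)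
    have hp' := (hp.of_agreeOff hf0 (by decide) (by decide) (by decide) I.k le_rfl).1
    have hu' : m' 21 0 = u := by rw [hf0 21 (by decide), hu]
    have hF' : m' 22 0 = mask F := by rw [hf0 22 (by decide), hF]
    have h15 : m' 15 = m 15 := hf0 15 (by decide)
    -- Cell `25` counts the unauthorized steps in `F`; by truncation `1 - m' 25 0` is `1` if there
    -- are none and `0` otherwise.
    have hval : (1 + m' 24 0) * (1 - m' 25 0) = I.userCell u F := by
      rw [i1, i2, hcode', Inst.userCell]
      have hz : countIn F (fun s => 1 - I.au s u) I.k = 0 ↔ ∀ s ∈ F, I.au s u ≠ 0 := by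
        rw [countIn_eq_zero]
        constructor
        · intro h s hs h0
          exact h s (mem_range.1 (hFk hs)) (by omega) hs
        · intro h s _ h0 hs
          have := h s hs
          omega
      split_ifs with h
      · rw [hz.2 h]
        omega
      · have := mt hz.1 h
        rw [show 1 - countIn F (fun s => 1 - I.au s u) I.k = 0 by omega, mul_zero]
    have hle : I.userCell u F < 2 ^ w := by
      rw [Inst.userCell]
      have := hw.n_pow
      split_ifs <;> omega
    refine .mono (.store (by simpa [hval] using hle) fun a => ?_) (by decide)
    simp [write_apply, masksExp, stepsExp, hu', hF', hI'.k, hp', hval, h15]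
  · have e : (0 : Exp).weight = 1 ∧ (0 : Exp).width = 0 := by decide
    rw [e.1, e.2]
    omega

/-- The cell of the set with the code `x` in the `p`-th table. -/
def Inst.tab (I : Inst) (m : Mem) (p x : ℕ) : ℕ := m 15 (p * 2 ^ I.k + x)

theorem Inst.tab_congr {I : Inst} {m m' : Mem} (h : m' 15 = m 15) : I.tab m' = I.tab m := by
  funext p x
  rw [tab, tab, h]

/-- Writes the tables of all users and points to them. -/
def usersCmd : Cmd :=
  .seq (.store 15 0 1) (.forLoop 21 (.var 0) (.seq (.forLoop 22 masksExp userCellCmd)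
    (.store 16 (.read 7 (.var 21)) (.var 21 + 1))))

/-- The state after the tables of the first `u` users have been written. -/
structure UsersInv (I : Inst) (u : ℕ) (m : Mem) : Prop where
  empty : ∀ x < 2 ^ I.k, I.tab m 0 x = if x = 0 then 1 else 0
  cell : ∀ v < u, ∀ F ⊆ range I.k, I.tab m (v + 1) (mask F) = I.userCell v F
  zero : ∀ p, u < p → ∀ x < 2 ^ I.k, I.tab m p x = 0
  ptr : ∀ v < u, m 16 (I.L 0 v) = v + 1
  ptr_zero : ∀ b, (∀ v < u, I.L 0 v ≠ b) → m 16 b = 0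

/-- Table `0` is reserved for the empty set of users, so user `u` owns table `u + 1` and a pointer
that was never set designates the empty table. By `hinj` the pointer of one user is not overwritten
by another. -/
theorem usersCmd_does {I : Inst} {w : ℕ} {m : Mem} (hI : Input I m) (hw : Fits I w)
    (hp : Powers I m) (h15 : ∀ a, m 15 a = 0) (h16 : ∀ a, m 16 a = 0)
    (hinj : ∀ u < I.n, ∀ v < I.n, I.L 0 u = I.L 0 v → u = v) :
    Does w usersCmd ((I.n + 2) * ((2 ^ I.k + 2) * ((I.k + 1) * 1000))) m (UsersInv I I.n) := by
  have h1 : 1 < 2 ^ w := (Nat.one_le_pow _ _ (by simp)).trans_lt hw.three_pow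
  have hq : 0 < 2 ^ I.k := by positivity
  refine .mono (.seq (.store h1 fun _ => Does.forLoop (cb := (2 ^ I.k + 1) * ((I.k + 1) * 1000) + 100)
    (C := (2 ^ I.k + 2) * ((I.k + 1) * 1000)) I.n ?_ (UsersInv I) hw.n (by decide) ?_ ?_ ?_ ?_)) ?_
  · have : (Exp.var 0).weight + (Exp.var 0).width + 40 ≤ 100 := by decide
    nlinarith
  · intro m' hm'
    simp [hm' 0 (by decide), write_of_ne, hI.n]
  · constructor
    · intro x _
      simp [Inst.tab, write_of_ne, write_apply, h15]
    · intro v hv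
      omega
    · intro p hp x _
      have : p * 2 ^ I.k + x ≠ 0 := by
        have := Nat.mul_pos hp hq
        omega
      simp [Inst.tab, write_of_ne, write_apply, h15, hp.ne']
    · intro v hv
      omega
    · simp [write_of_ne, h16]
  · intro u m₁ hu hf hv₁ ih
    have hf₁ : AgreeOff (15 :: 21 :: (Cmd.seq (.forLoop 22 masksExp userCellCmd)
        (.store 16 (.read 7 (.var 21)) (.var 21 + 1))).mods) m m₁ := by
      intro a ha
      simp only [List.mem_cons, not_or] at ha
      rw [hf a (by simpa using ha.2), write_of_ne ha.1]
    have hI₁ := hI.of_agreeOff hf₁ (by decide)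
    have hp₁ := hp.of_agreeOff hf₁ (by decide) (by decide) (by decide)
    refine .mono (.seq (N₂ := 50) (Does.forLoop (cb := (I.k + 1) * 900) (C := (I.k + 1) * 1000)
      (2 ^ I.k) ?_ (fun x m' => (∀ F ⊆ range I.k, mask F < x →
        I.tab m' (u + 1) (mask F) = I.userCell u F) ∧
        ∀ p, p ≠ u + 1 → ∀ x < 2 ^ I.k, I.tab m' p x = I.tab m₁ p x)
      hw.two_pow (by decide) ?_ ?_ ?_ ?_)) (by omega)
    · have : masksExp.weight + masksExp.width + 40 ≤ 100 := by decide
      nlinarith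
    · intro m' hm'
      simp [masksExp, stepsExp, hm' 0 (by decide), hm' 9 (by decide), hI₁.k, (hp₁ I.k le_rfl).1]
    · simp [Inst.tab, write_of_ne]
    · intro x m₂ hx hf₂ hv₂ ⟨i1, i2⟩
      obtain ⟨F, hF, rfl⟩ := exists_mask_eq hx
      refine (userCellCmd_does (hI₁.of_agreeOff hf₂ (by decide)) hw
        (hp₁.of_agreeOff hf₂ (by decide) (by decide) (by decide))
        (by rw [hf₂ 21 (by decide), hv₁]) hu hv₂ hF).imp fun m₃ _ h₃ _ => ?_
      constructor
      · intro G hG hGF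
        rw [Inst.tab, write_of_ne (by simp), h₃]
        simp only [pair_inj (mask_lt hG) hx, true_and]
        by_cases h : mask G = mask F
        · rw [if_pos h, mask_inj h]
        · rw [if_neg h]
          exact i1 G hG (by omega)
      · intro p hpu y hy
        rw [Inst.tab, write_of_ne (by simp), h₃, if_neg fun h' => hpu ((pair_inj hy hx).1 h').1]
        exact i2 p hpu y hy
    · intro m₂ hf₂ ⟨i1, i2⟩ _
      have hI₂ := hI₁.of_agreeOff hf₂ (by decide)
      have hv₂ : m₂ 21 0 = u := by rw [hf₂ 21 (by decide), hv₁]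
      have hL : m₂ 7 u = I.L 0 u := by simpa using hI₂.L 0 u
      have h16₂ : m₂ 16 = m₁ 16 := hf₂ 16 (by decide)
      have := hw.n
      refine .mono (.store (by simp [hv₂]; omega) fun _ => ?_) (by decide)
      have htab : ∀ e : ℕ, I.tab ((m₂.write 16 e (u + 1)).write 21 0 (u + 1)) = I.tab m₂ :=
        fun e => Inst.tab_congr (by simp [write_of_ne])
      simp only [Exp.eval_add, Exp.eval_var, Exp.eval_read, Exp.eval_one, hv₂, hL]
      constructor
      · intro x hx
        rw [htab, i2 0 (by omega) x hx, ih.empty x hx]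
      · intro v hv F hF
        rw [htab]
        rcases Nat.lt_succ_iff_lt_or_eq.1 hv with hv | rfl
        · rw [i2 _ (by omega) _ (mask_lt hF), ih.cell v hv F hF]
        · exact i1 F hF (mask_lt hF)
      · intro p hp x hx
        rw [htab, i2 p (by omega) x hx, ih.zero p (by omega) x hx]
      · intro v hv
        rw [write_of_ne (by simp), write_apply, h16₂]
        rcases Nat.lt_succ_iff_lt_or_eq.1 hv with hv | rfl
        · rw [if_neg fun h => hv.ne (hinj v (hv.trans hu) u hu h), ih.ptr v hv]
        · rw [if_pos rfl]
      · intro b hb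
        rw [write_of_ne (by simp), write_apply, h16₂, if_neg (hb u (by omega)).symm,
          ih.ptr_zero b fun v hv => hb v (by omega)]
  · intro m' _ h
    exact h
  · have e : (0 : Exp).weight = 1 ∧ (0 : Exp).width = 0 ∧ (1 : Exp).weight = 2 ∧
      (1 : Exp).width = 1 := by decide
    rw [e.1, e.2.1, e.2.2.1, e.2.2.2]
    nlinarith

/-! ## The program: merging the tables -/

open Classical in
/-- The input and the auxiliary tables that do not change any more. -/
structure Env (I : Inst) (m : Mem) : Prop where
  input : Input I m
  powers : Powers I m
  ternary : ∀ t < 3 ^ I.k, m 12 t = recode₁ t ∧ m 13 t = recode₂ t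
  bad : ∀ i, ∀ F ⊆ range I.k, m 14 (i * 2 ^ I.k + mask F) = if I.Bad i F then 1 else 0

theorem Env.of_agreeOff {I : Inst} {l : List ℕ} {m m' : Mem} (h : Env I m)
    (hm : AgreeOff l m m') (hl : ∀ a < 15, a ≠ 8 → a ∉ l) : Env I m' where
  input := h.input.of_agreeOff hm fun a ha => hl a (by omega) (by omega)
  powers := h.powers.of_agreeOff hm (hl 9 (by simp) (by simp)) (hl 10 (by simp) (by simp))
    (hl 11 (by simp) (by simp))
  ternary := by
    rw [hm 12 (hl 12 (by simp) (by simp)), hm 13 (hl 13 (by simp) (by simp))]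
    exact h.ternary
  bad := by
    rw [hm 14 (hl 14 (by simp) (by simp))]
    exact h.bad

/-- The number of the table that is written for the level `20` and the user `21`. -/
def targetExp : Exp := (.var 20 + 1) * .var 0 + .var 21 + 1

/-- Merges the table `25` with the table `24`, restricted to the sets that are not bad for the
level `20`. -/
def mergeCmd : Cmd :=
  .forLoop 22 (.read 11 stepsExp)
    (.seq (.store 26 0 (.read 15 (.var 25 * masksExp + .read 12 (.var 22))))
    (.seq (.store 27 0 (.read 15 (.var 24 * masksExp + .read 13 (.var 22)) *
        (1 - .read 14 (.var 20 * masksExp + .read 13 (.var 22)))))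
      (.ite (.var 26 * .var 27)
        (.store 15 (targetExp * masksExp + (.read 12 (.var 22) + .read 13 (.var 22)))
          (.var 26 + .var 27 - 1)) .skip)))

/-- The `p`-th table, restricted to the sets that are not bad for the level `i`. -/
def Inst.goodTab (I : Inst) (m : Mem) (i p x : ℕ) : ℕ :=
  I.tab m p x * (1 - m 14 (i * 2 ^ I.k + x))

theorem recode_add_lt {k t : ℕ} (ht : t < 3 ^ k) : recode₁ t + recode₂ t < 2 ^ k := by
  obtain ⟨F, G, hF, hG, h, h1, h2⟩ := exists_disjoint_of_lt ht
  rw [h1, h2, ← mask_union h]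
  exact mask_lt (union_subset hF hG)

/-- The target table is fresh: it is zero at the start and its number exceeds `p` and `q`, so both
sources stay intact. A target cell may be written several times. Each value written is correct,
hence soundness refers to the latest write, and completeness only needs that a written cell never
returns to zero. -/
theorem mergeCmd_does {I : Inst} {w i u p q : ℕ} {m : Mem} (hE : Env I m) (hw : Fits I w)
    (hi : m 20 0 = i) (hu : m 21 0 = u) (hq : m 24 0 = q) (hp : m 25 0 = p)
    (hps : p < (i + 1) * I.n + u + 1) (hqs : q < (i + 1) * I.n + u + 1)
    (hz : ∀ x < 2 ^ I.k, I.tab m ((i + 1) * I.n + u + 1) x = 0)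
    (hb : ∀ t < 3 ^ I.k, I.tab m p (recode₁ t) ≠ 0 → I.goodTab m i q (recode₂ t) ≠ 0 →
      I.tab m p (recode₁ t) + I.goodTab m i q (recode₂ t) - 1 < 2 ^ w) :
    Does w mergeCmd ((3 ^ I.k + 1) * 1000) m fun m' =>
      (∀ a, a ≠ (i + 1) * I.n + u + 1 → ∀ x < 2 ^ I.k, I.tab m' a x = I.tab m a x) ∧
      (∀ x < 2 ^ I.k, I.tab m' ((i + 1) * I.n + u + 1) x ≠ 0 → ∃ t < 3 ^ I.k,
        recode₁ t + recode₂ t = x ∧ I.tab m p (recode₁ t) ≠ 0 ∧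
        I.goodTab m i q (recode₂ t) ≠ 0 ∧ I.tab m' ((i + 1) * I.n + u + 1) x =
          I.tab m p (recode₁ t) + I.goodTab m i q (recode₂ t) - 1) ∧
      (∀ t < 3 ^ I.k, I.tab m p (recode₁ t) ≠ 0 → I.goodTab m i q (recode₂ t) ≠ 0 →
        I.tab m' ((i + 1) * I.n + u + 1) (recode₁ t + recode₂ t) ≠ 0) := by
  set r := (i + 1) * I.n + u + 1 with hr
  refine Does.forLoop (cb := 900) (3 ^ I.k) (by decide) (fun j m' =>
      (∀ a, a ≠ r → ∀ x < 2 ^ I.k, I.tab m' a x = I.tab m a x) ∧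
      (∀ x < 2 ^ I.k, I.tab m' r x ≠ 0 → ∃ t < j,
        recode₁ t + recode₂ t = x ∧ I.tab m p (recode₁ t) ≠ 0 ∧
        I.goodTab m i q (recode₂ t) ≠ 0 ∧ I.tab m' r x =
          I.tab m p (recode₁ t) + I.goodTab m i q (recode₂ t) - 1) ∧
      (∀ t < j, I.tab m p (recode₁ t) ≠ 0 → I.goodTab m i q (recode₂ t) ≠ 0 →
        I.tab m' r (recode₁ t + recode₂ t) ≠ 0))
    hw.three_pow (by decide) ?_ ?_ ?_ ?_
  · intro m' hm'
    simp [stepsExp, hm' 0 (by decide), hm' 11 (by decide), hE.input.k, (hE.powers I.k le_rfl).2.2]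
  · have ht : I.tab (m.write 22 0 0) = I.tab m := Inst.tab_congr (by simp [write_of_ne])
    rw [ht]
    exact ⟨fun _ _ _ _ => rfl, fun x hx h => absurd (hz x hx) h, fun t ht => absurd ht (by simp)⟩
  · intro j m₁ hj hf hv ⟨i1, i2, i3⟩
    have hE₁ := hE.of_agreeOff hf (by decide)
    have hk := hE₁.input.k
    have hn := hE₁.input.n
    have hM := (hE₁.powers I.k le_rfl).1
    obtain ⟨t1, t2⟩ := hE₁.ternary j hj
    obtain ⟨l1, l2⟩ := recode_lt hj
    have l3 := recode_add_lt hj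
    have hi₁ : m₁ 20 0 = i := by rw [hf 20 (by decide), hi]
    have hu₁ : m₁ 21 0 = u := by rw [hf 21 (by decide), hu]
    have hq₁ : m₁ 24 0 = q := by rw [hf 24 (by decide), hq]
    have hp₁ : m₁ 25 0 = p := by rw [hf 25 (by decide), hp]
    have h14 : m₁ 14 = m 14 := hf 14 (by decide)
    have x1 : m₁ 15 (p * 2 ^ I.k + recode₁ j) = I.tab m p (recode₁ j) := i1 p (by omega) _ l1
    have x2 : m₁ 15 (q * 2 ^ I.k + recode₂ j) * (1 - m 14 (i * 2 ^ I.k + recode₂ j)) =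
        I.goodTab m i q (recode₂ j) := by
      rw [Inst.goodTab, ← i1 q (by omega) _ l2, Inst.tab]
    -- Boundedness of the memory is needed here to bound the two table entries that are copied to
    -- scratch cells.
    intro hB
    have b1 : I.tab m p (recode₁ j) < 2 ^ w := x1 ▸ hB 15 _
    have b2 : I.goodTab m i q (recode₂ j) < 2 ^ w := by
      have h1 := hB 15 (q * 2 ^ I.k + recode₂ j)
      have h2 : m₁ 15 (q * 2 ^ I.k + recode₂ j) * (1 - m 14 (i * 2 ^ I.k + recode₂ j)) ≤
          m₁ 15 (q * 2 ^ I.k + recode₂ j) := (Nat.mul_le_mul_left _ (Nat.sub_le _ _)).trans_eq (mul_one _)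
      omega
    revert hB
    -- The scratch stores do not touch array `15`; one round therefore has two outcomes, a single
    -- write to the target table or none.
    have key : ∀ {Q : Mem → Prop}, (∀ m₂, m₂ 15 = m₁ 15 →
        (I.tab m p (recode₁ j) * I.goodTab m i q (recode₂ j) ≠ 0 →
          Q (m₂.write 15 (r * 2 ^ I.k + (recode₁ j + recode₂ j))
            (I.tab m p (recode₁ j) + I.goodTab m i q (recode₂ j) - 1))) ∧
        (I.tab m p (recode₁ j) * I.goodTab m i q (recode₂ j) = 0 → Q m₂)) →
        Does w (.seq (.store 26 0 (.read 15 (.var 25 * masksExp + .read 12 (.var 22))))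
          (.seq (.store 27 0 (.read 15 (.var 24 * masksExp + .read 13 (.var 22)) *
              (1 - .read 14 (.var 20 * masksExp + .read 13 (.var 22)))))
            (.ite (.var 26 * .var 27)
              (.store 15 (targetExp * masksExp + (.read 12 (.var 22) + .read 13 (.var 22)))
                (.var 26 + .var 27 - 1)) .skip))) 900 m₁ Q := by
      intro Q hQ
      have hw := hb j hj
      refine .mono (.seq (.store ?_ fun _ => .seq (.store ?_ fun _ => .ite (N := 300)
        (fun h => .mono (.store ?_ ?_) (by decide)) fun h => .mono (.skip ?_) (by simp)))) (by decide)
      · simpa [masksExp, stepsExp, hv, hp₁, hk, hM, t1, x1] using b1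
      · simpa [masksExp, stepsExp, write_of_ne, hv, hi₁, hq₁, hk, hM, t2, h14, x2] using b2
      · simp [masksExp, stepsExp, write_of_ne, hv, hi₁, hp₁, hq₁, hk, hM, t1, t2, h14, x1, x2] at h ⊢
        exact hw h.1 h.2
      · simp [masksExp, stepsExp, targetExp, write_of_ne, hv, hi₁, hu₁, hn, hp₁, hq₁, hk, hM, t1, t2,
          h14, x1, x2] at h ⊢
        exact (hQ _ (by simp [write_of_ne])).1 (mul_ne_zero h.1 h.2)
      · simp [masksExp, stepsExp, write_of_ne, hv, hi₁, hp₁, hq₁, hk, hM, t1, t2, h14, x1, x2] at h ⊢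
        exact (hQ _ (by simp [write_of_ne])).2 (mul_eq_zero.2 h)
    refine key fun m₂ hm₂ => ⟨fun h _ => ?_, fun h _ => ?_⟩
    · obtain ⟨h1, h2⟩ := mul_ne_zero_iff.1 h
      have ht : ∀ a, ∀ x < 2 ^ I.k, I.tab ((m₂.write 15 (r * 2 ^ I.k + (recode₁ j + recode₂ j))
          (I.tab m p (recode₁ j) + I.goodTab m i q (recode₂ j) - 1)).write 22 0 (j + 1)) a x =
          if a = r ∧ x = recode₁ j + recode₂ j then
            I.tab m p (recode₁ j) + I.goodTab m i q (recode₂ j) - 1 else I.tab m₁ a x := by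
        intro a x hx
        rw [Inst.tab, write_of_ne (by simp), write_apply, hm₂]
        exact if_congr (pair_inj hx l3) rfl rfl
      refine ⟨fun a ha x hx => ?_, fun x hx h0 => ?_, fun t htj h1' h2' => ?_⟩
      · rw [ht a x hx, if_neg fun h' => ha h'.1, i1 a ha x hx]
      · rw [ht r x hx] at h0 ⊢
        by_cases hx' : x = recode₁ j + recode₂ j
        · exact ⟨j, by omega, hx'.symm, h1, h2, if_pos ⟨rfl, hx'⟩⟩
        · rw [if_neg fun h' => hx' h'.2] at h0 ⊢
          obtain ⟨t, h3, h4⟩ := i2 x hx h0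
          exact ⟨t, by omega, h4⟩
      · rw [ht r _ (recode_add_lt (by omega))]
        split_ifs with hx'
        · omega
        · rcases Nat.lt_succ_iff_lt_or_eq.1 htj with h3 | rfl
          · exact i3 t h3 h1' h2'
          · exact absurd ⟨rfl, rfl⟩ hx'
    · have ht : I.tab (m₂.write 22 0 (j + 1)) = I.tab m₁ :=
        Inst.tab_congr (by rw [write_of_ne (by simp), hm₂])
      rw [ht]
      refine ⟨i1, fun x hx h0 => ?_, fun t htj h1' h2' => ?_⟩
      · obtain ⟨t, h3, h4⟩ := i2 x hx h0
        exact ⟨t, by omega, h4⟩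
      · rcases Nat.lt_succ_iff_lt_or_eq.1 htj with h3 | rfl
        · exact i3 t h3 h1' h2'
        · exact absurd h (mul_ne_zero h1' h2')
  · intro m' _ h
    exact h

/-! ### Invariants of the passage from one level to the next -/

namespace Inst

variable {I : Inst} {i : ℕ} {X Y : Set ℕ} {T T' T₁ T₂ T₃ : ℕ → ℕ}

theorem Rep.congr (h : I.Rep i X T) (hT : ∀ x < 2 ^ I.k, T' x = T x) : I.Rep i X T' := by
  intro F hF
  rw [hT _ (mask_lt hF)]
  exact h F hF

theorem Rep.merge (h₁ : I.Rep i X T₁) (h₂ : I.Rep i Y T₂)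
    (sep : ∀ i' < i, ∀ x ∈ X, ∀ y ∈ Y, I.L i' x ≠ I.L i' y)
    (sound : ∀ x < 2 ^ I.k, T₃ x ≠ 0 → ∃ t < 3 ^ I.k, recode₁ t + recode₂ t = x ∧
      T₁ (recode₁ t) ≠ 0 ∧ T₂ (recode₂ t) ≠ 0 ∧ T₃ x = T₁ (recode₁ t) + T₂ (recode₂ t) - 1)
    (complete : ∀ t < 3 ^ I.k, T₁ (recode₁ t) ≠ 0 → T₂ (recode₂ t) ≠ 0 →
      T₃ (recode₁ t + recode₂ t) ≠ 0) :
    I.Rep i (X ∪ Y) T₃ := by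
  refine h₁.union h₂ sep (fun H hH h0 => ?_) fun F hF G hG hFG h1 h2 => ?_
  · obtain ⟨t, ht, e, h⟩ := sound _ (mask_lt hH) h0
    obtain ⟨F, G, hF, hG, hFG, e1, e2⟩ := exists_disjoint_of_lt ht
    rw [e1, e2] at h
    rw [e1, e2, ← mask_union hFG] at e
    exact ⟨F, hF, G, hG, hFG, mask_inj e, h⟩
  · obtain ⟨t, ht, e1, e2⟩ := exists_lt_of_disjoint hF hG hFG
    rw [mask_union hFG, ← e1, ← e2]
    exact complete t ht (e1 ▸ h1) (e2 ▸ h2)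

theorem Rep.goodTab {m : Mem} {p b : ℕ} (h : I.Rep i X (I.tab m p)) (hE : Env I m)
    (hX : ∀ x ∈ X, I.L i x = b) : I.Rep (i + 1) X (I.goodTab m i p) := by
  refine h.filter hX fun F hF => ?_
  rw [Inst.goodTab, hE.bad i F hF]
  split_ifs with hb <;> simp [hb]

/-- The levels are coarser and coarser partitions, from singletons to a single block. -/
structure Canonical (I : Inst) : Prop where
  ℓ_pos : 0 < I.ℓ
  L_lt : ∀ i < I.ℓ, ∀ u < I.n, I.L i u < I.n
  refines : ∀ i, i + 1 < I.ℓ → ∀ u < I.n, ∀ v < I.n, I.L i u = I.L i v → I.L (i + 1) u = I.L (i + 1) v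
  bot : ∀ u < I.n, ∀ v < I.n, I.L 0 u = I.L 0 v → u = v
  top : ∀ u < I.n, ∀ v < I.n, I.L (I.ℓ - 1) u = I.L (I.ℓ - 1) v

theorem Canonical.refines_le (h : I.Canonical) {i j u v : ℕ} (hij : i ≤ j) (hj : j < I.ℓ)
    (hu : u < I.n) (hv : v < I.n) (huv : I.L i u = I.L i v) : I.L j u = I.L j v := by
  induction j, hij using Nat.le_induction with
  | base => exact huv
  | succ j _ ih => exact h.refines j hj u hu v hv (ih (by omega))

/-- The block `b` of level `i`. -/
def block (I : Inst) (i b : ℕ) : Set ℕ := {v | v < I.n ∧ I.L i v = b}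

/-- The users in the blocks of level `i` that contain one of the first `u` users. -/
def reached (I : Inst) (i u : ℕ) : Set ℕ := {v | ∃ u' < u, I.L i u' = I.L i v}

/-- The state when the tables of the blocks of level `i` are complete. -/
structure LevelInv (I : Inst) (i : ℕ) (m : Mem) : Prop where
  empty : ∀ x < 2 ^ I.k, I.tab m 0 x = if x = 0 then 1 else 0
  zero : ∀ p ≥ (i + 1) * I.n + 1, ∀ x < 2 ^ I.k, I.tab m p x = 0
  ptr_lt : ∀ b < I.n, m 16 (i * I.n + b) < (i + 1) * I.n + 1
  rep : ∀ b < I.n, I.Rep i (I.block i b) (I.tab m (m 16 (i * I.n + b)))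
  next : ∀ a ≥ (i + 1) * I.n, m 16 a = 0

/-- The state when the blocks of level `i` that contain one of the first `u` users have been merged
into the blocks of the next level. -/
structure MergeInv (I : Inst) (i u : ℕ) (m : Mem) : Prop where
  empty : ∀ x < 2 ^ I.k, I.tab m 0 x = if x = 0 then 1 else 0
  zero : ∀ p ≥ (i + 1) * I.n + u + 1, ∀ x < 2 ^ I.k, I.tab m p x = 0
  child_lt : ∀ b < I.n, m 16 (i * I.n + b) < (i + 1) * I.n + u + 1
  child : ∀ b < I.n, I.Rep i (I.block i b \ I.reached i u) (I.tab m (m 16 (i * I.n + b)))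
  parent_lt : ∀ b < I.n, m 16 ((i + 1) * I.n + b) < (i + 1) * I.n + u + 1
  parent : ∀ b < I.n, I.Rep (i + 1) (I.block (i + 1) b ∩ I.reached i u)
    (I.tab m (m 16 ((i + 1) * I.n + b)))
  next : ∀ a ≥ (i + 1 + 1) * I.n, m 16 a = 0

/-- No user is reached yet: the children are whole, and the pointers of the parents are still `0`,
which is the correct table for the empty set. -/
theorem LevelInv.mergeInv {m : Mem} (h : I.LevelInv i m) : I.MergeInv i 0 m where
  empty := h.empty
  zero := h.zero
  child_lt := h.ptr_lt
  child b hb := by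
    have : I.block i b \ I.reached i 0 = I.block i b := by simp [reached]
    rw [this]
    exact h.rep b hb
  parent_lt b hb := by rw [h.next _ (by omega)]; omega
  parent b hb := by
    have : I.block (i + 1) b ∩ I.reached i 0 = ∅ := by simp [reached]
    rw [this, h.next _ (by omega)]
    exact rep_empty _ h.empty
  next a ha := h.next a (by nlinarith)

theorem MergeInv.levelInv {m : Mem} (h : I.MergeInv i I.n m) : I.LevelInv (i + 1) m where
  empty := h.empty
  zero p hp := h.zero p (by nlinarith)
  ptr_lt b hb := by have := h.parent_lt b hb; nlinarith
  rep b hb := by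
    have : I.block (i + 1) b ∩ I.reached i I.n = I.block (i + 1) b :=
      Set.inter_eq_left.2 fun v hv => ⟨v, hv.1, rfl⟩
    have h' := h.parent b hb
    rwa [this] at h'
  next := h.next

theorem MergeInv.congr {m m' : Mem} {u : ℕ} (h : I.MergeInv i u m) (h15 : m' 15 = m 15)
    (h16 : m' 16 = m 16) : I.MergeInv i u m' := by
  have ht := Inst.tab_congr (I := I) h15
  obtain ⟨h1, h2, h3, h4, h5, h6, h7⟩ := h
  refine ⟨?_, ?_, ?_, ?_, ?_, ?_, ?_⟩ <;> simp only [ht, h16] <;> assumption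

end Inst

/-- The cell of the array `16` for the block of the user `21` at the level `20`. -/
def childExp : Exp := .var 20 * .var 0 + .read 7 (.var 0 * .var 20 + .var 21)

/-- The cell of the array `16` for the block of the user `21` above the level `20`. -/
def parentExp : Exp := (.var 20 + 1) * .var 0 + .read 7 (.var 0 * (.var 20 + 1) + .var 21)

/-- Merges the block of the user `21` at the level `20` into its block at the next level. -/
def mergeUserCmd : Cmd :=
  .seq (.store 24 0 (.read 16 childExp)) (.seq (.store 25 0 (.read 16 parentExp))
    (.seq mergeCmd (.seq (.store 16 parentExp targetExp) (.store 16 childExp 0))))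

theorem Does.of_bounded {w N : ℕ} {p : Cmd} {m : Mem} {Q : Mem → Prop}
    (h : Bounded w m → Does w p N m Q) : Does w p N m Q := fun hm => h hm hm

/-- The loop runs over users and not over blocks, so a block is met once for each of its members.
After the first visit its pointer is reset to the empty table, in accordance with `block \ reached`
being empty; later visits merge nothing into the parent and merely copy its table to a fresh place.
-/
theorem merge_store_does {I : Inst} {w i u : ℕ} {m : Mem} (hE : Env I m) (hw : Fits I w)
    (hC : I.Canonical) (hi : m 20 0 = i) (hu : m 21 0 = u) (hiℓ : i + 1 < I.ℓ) (hun : u < I.n)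
    (hM : I.MergeInv i u m) (h24 : m 24 0 = m 16 (i * I.n + I.L i u))
    (h25 : m 25 0 = m 16 ((i + 1) * I.n + I.L (i + 1) u)) :
    Does w (.seq mergeCmd (.seq (.store 16 parentExp targetExp) (.store 16 childExp 0)))
      ((3 ^ I.k + 1) * 1000 + 200) m (I.MergeInv i (u + 1)) := by
  have hb1 := hC.L_lt i (by omega) u hun
  have hb2 := hC.L_lt (i + 1) hiℓ u hun
  have hqs := hM.child_lt _ hb1
  have hps := hM.parent_lt _ hb2
  have hrw : (i + 1) * I.n + u + 1 < 2 ^ w := by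
    have := hw.tables
    nlinarith
  have child := (hM.child _ hb1).goodTab hE (b := I.L i u) (fun x hx => hx.1.2)
  have parent := hM.parent _ hb2
  refine .mono (.seq (N₂ := 200) (.imp (mergeCmd_does hE hw hi hu h24 h25 hps hqs
    (hM.zero _ le_rfl) fun t ht h1 h2 => ?_) ?_)) le_rfl
  · obtain ⟨F, G, hF, hG, hFG, e1, e2⟩ := exists_disjoint_of_lt ht
    rw [e1] at h1 ⊢
    rw [e2] at h2 ⊢
    exact (parent.add_le child hw.n_pos (fun x hx => hx.1.1) (fun x hx => hx.1.1) hF hG hFG h1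
      h2).trans_lt hw.n_pow
  · intro m₁ hf ⟨m1, m2, m3⟩ _
    have hE₁ := hE.of_agreeOff hf (by decide)
    have hn := hE₁.input.n
    have hL1 := hE₁.input.L i u
    have hL2 := hE₁.input.L (i + 1) u
    have hi₁ : m₁ 20 0 = i := by rw [hf 20 (by decide), hi]
    have hu₁ : m₁ 21 0 = u := by rw [hf 21 (by decide), hu]
    have h16 : m₁ 16 = m 16 := hf 16 (by decide)
    refine .mono (.seq (.store (by simpa [targetExp, hn, hi₁, hu₁] using hrw) fun _ =>
      .store (by simp) ?_)) (by decide)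
    simp only [parentExp, targetExp, childExp, Exp.eval_add, Exp.eval_mul, Exp.eval_var,
      Exp.eval_read, Exp.eval_one, Exp.eval_zero, hn, hi₁, hu₁, hL1, hL2, ne_eq, Nat.reduceEqDiff,
      not_false_eq_true, write_of_ne, OfNat.zero_ne_ofNat]
    set r := (i + 1) * I.n + u + 1 with hr
    set m₂ := (m₁.write 16 ((i + 1) * I.n + I.L (i + 1) u) r).write 16 (i * I.n + I.L i u) 0
    have ht : I.tab m₂ = I.tab m₁ := Inst.tab_congr (by simp [m₂, write_of_ne])
    have hptr : ∀ a, m₂ 16 a = if a = i * I.n + I.L i u then 0 else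
        if a = (i + 1) * I.n + I.L (i + 1) u then r else m 16 a := by
      intro a
      simp only [m₂, write_apply, h16]
    have hchild : ∀ b < I.n, m₂ 16 (i * I.n + b) =
        if b = I.L i u then 0 else m 16 (i * I.n + b) := by
      intro b hb
      simp only [hptr, pair_inj hb hb1, pair_inj hb hb2, true_and]
      simp
    have hparent : ∀ b < I.n, m₂ 16 ((i + 1) * I.n + b) =
        if b = I.L (i + 1) u then r else m 16 ((i + 1) * I.n + b) := by
      intro b hb
      simp only [hptr, pair_inj hb hb1, pair_inj hb hb2, true_and]
      simp
    have hrefl : ∀ v, v < I.n → I.L i u = I.L i v → I.L (i + 1) v = I.L (i + 1) u :=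
      fun v hv h => (hC.refines i hiℓ u hun v hv h).symm
    refine ⟨?_, ?_, ?_, ?_, ?_, ?_, ?_⟩
    · intro x hx
      rw [ht, m1 0 (by omega) x hx, hM.empty x hx]
    · intro p hp x hx
      rw [ht, m1 p (by omega) x hx, hM.zero p (by omega) x hx]
    · intro b hb
      have := hM.child_lt b hb
      rw [hchild b hb]
      split_ifs <;> omega
    · intro b hb
      rw [hchild b hb, ht]
      split_ifs with h
      · have : I.block i b \ I.reached i (u + 1) = ∅ := by
          rw [Set.sdiff_eq_empty]
          exact fun v hv => ⟨u, by omega, by rw [hv.2, h]⟩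
        rw [this]
        exact Inst.rep_empty _ fun x hx => by rw [m1 0 (by omega) x hx, hM.empty x hx]
      · have : I.block i b \ I.reached i (u + 1) = I.block i b \ I.reached i u := by
          ext v
          simp only [Set.mem_sdiff, Inst.block, Inst.reached, Set.mem_ofPred_eq, not_exists, not_and]
          refine and_congr_right fun hv => ⟨fun h' u' hu' => h' u' (by omega), fun h' u' hu' => ?_⟩
          rcases Nat.lt_succ_iff_lt_or_eq.1 hu' with hu' | rfl
          · exact h' u' hu'
          · exact fun h'' => h (by rw [h'', hv.2])
        rw [this]
        have := hM.child_lt b hb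
        exact (hM.child b hb).congr fun x hx => m1 _ (by omega) x hx
    · intro b hb
      have := hM.parent_lt b hb
      rw [hparent b hb]
      split_ifs <;> omega
    · intro b hb
      rw [hparent b hb, ht]
      split_ifs with h
      · subst h
        have : I.block (i + 1) (I.L (i + 1) u) ∩ I.reached i (u + 1) =
            (I.block (i + 1) (I.L (i + 1) u) ∩ I.reached i u) ∪
              (I.block i (I.L i u) \ I.reached i u) := by
          ext v
          simp only [Set.mem_union, Set.mem_inter_iff, Set.mem_sdiff, Inst.block, Inst.reached,
            Set.mem_ofPred_eq]
          constructor
          · rintro ⟨hv, u', hu', h'⟩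
            by_cases hr' : ∃ u' < u, I.L i u' = I.L i v
            · exact .inl ⟨hv, hr'⟩
            · refine .inr ⟨⟨hv.1, ?_⟩, hr'⟩
              rcases Nat.lt_succ_iff_lt_or_eq.1 hu' with hu' | rfl
              · exact absurd ⟨u', hu', h'⟩ hr'
              · exact h'.symm
          · rintro (⟨hv, u', hu', h'⟩ | ⟨⟨hv, h'⟩, -⟩)
            · exact ⟨hv, u', by omega, h'⟩
            · exact ⟨⟨hv, hrefl v hv h'.symm⟩, u, by omega, h'.symm⟩
        rw [this]
        -- Separation: a common label of `x` and `y` at some level `i' ≤ i` would persist up to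
        -- level `i`, and then `y` would lie in a block already reached.
        refine parent.merge child (fun i' hi' x hx y hy hxy => ?_) m2 m3
        obtain ⟨u', hu', h'⟩ := hx.2
        exact hy.2 ⟨u', hu', h'.trans (hC.refines_le (Nat.le_of_lt_succ hi') (by omega) hx.1.1
          hy.1.1 hxy)⟩
      · have : I.block (i + 1) b ∩ I.reached i (u + 1) = I.block (i + 1) b ∩ I.reached i u := by
          ext v
          simp only [Set.mem_inter_iff, Inst.block, Inst.reached, Set.mem_ofPred_eq]
          refine and_congr_right fun hv => ⟨fun ⟨u', hu', h'⟩ => ?_,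
            fun ⟨u', hu', h'⟩ => ⟨u', by omega, h'⟩⟩
          rcases Nat.lt_succ_iff_lt_or_eq.1 hu' with hu' | rfl
          · exact ⟨u', hu', h'⟩
          · exact absurd (by rw [← hrefl v hv.1 h', hv.2]) h
        rw [this]
        have := hM.parent_lt b hb
        exact (hM.parent b hb).congr fun x hx => m1 _ (by omega) x hx
    · intro a ha
      rw [hptr, if_neg, if_neg, hM.next a ha] <;> nlinarith

theorem mergeUserCmd_does {I : Inst} {w i u : ℕ} {m : Mem} (hE : Env I m) (hw : Fits I w)
    (hC : I.Canonical) (hi : m 20 0 = i) (hu : m 21 0 = u) (hiℓ : i + 1 < I.ℓ) (hun : u < I.n)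
    (hM : I.MergeInv i u m) :
    Does w mergeUserCmd ((3 ^ I.k + 2) * 1000) m (I.MergeInv i (u + 1)) := by
  refine .of_bounded fun hB => ?_
  have hQ : m 16 (i * I.n + I.L i u) < 2 ^ w := hB 16 _
  have hP : m 16 ((i + 1) * I.n + I.L (i + 1) u) < 2 ^ w := hB 16 _
  have hn := hE.input.n
  have hL1 := hE.input.L i u
  have hL2 := hE.input.L (i + 1) u
  have hN : 100 + (100 + ((3 ^ I.k + 1) * 1000 + 200)) ≤ (3 ^ I.k + 2) * 1000 := by omega
  refine .mono (.seq (.mono (.store (by simpa [childExp, hi, hu, hn, hL1] using hQ) fun _ => ?_)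
    (by decide))) hN
  refine .seq (.mono (.store
    (by simpa [parentExp, write_of_ne, hi, hu, hn, hL2] using hP) fun _ => ?_) (by decide))
  simp only [parentExp, childExp, Exp.eval_add, Exp.eval_mul, Exp.eval_var,
    Exp.eval_read, Exp.eval_one, Exp.eval_zero, hn, hi, hu, hL1, hL2, ne_eq, Nat.reduceEqDiff,
    not_false_eq_true, write_of_ne, OfNat.zero_ne_ofNat]
  have hf : ∀ x y, AgreeOff [24, 25] m ((m.write 24 0 x).write 25 0 y) := by
    intro x y a ha
    simp only [List.mem_cons, not_or] at ha
    simp [write_of_ne, ha]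
  refine merge_store_does (hE.of_agreeOff (hf _ _) (by decide)) hw hC ?_ ?_ hiℓ hun
    (hM.congr ?_ ?_) ?_ ?_ <;> simp [write_of_ne, hi, hu]

/-- Merges the tables level by level. -/
def levelsCmd : Cmd := .forLoop 20 (.read 0 3 - 1) (.forLoop 21 (.var 0) mergeUserCmd)

theorem Inst.LevelInv.congr {I : Inst} {m m' : Mem} {i : ℕ} (h : I.LevelInv i m)
    (h15 : m' 15 = m 15) (h16 : m' 16 = m 16) : I.LevelInv i m' := by
  have ht := Inst.tab_congr (I := I) h15
  obtain ⟨h1, h2, h3, h4, h5⟩ := h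
  refine ⟨?_, ?_, ?_, ?_, ?_⟩ <;> simp only [ht, h16] <;> assumption

theorem levelsCmd_does {I : Inst} {w : ℕ} {m : Mem} (hE : Env I m) (hw : Fits I w)
    (hC : I.Canonical) (hM : I.LevelInv 0 m) :
    Does w levelsCmd (I.ℓ * ((I.n + 2) * ((3 ^ I.k + 3) * 1000))) m (I.LevelInv (I.ℓ - 1)) := by
  have hn1 := hw.n_pos
  have hℓ := hC.ℓ_pos
  have hℓw : I.ℓ - 1 < 2 ^ w := by
    have := hw.tables
    have : I.ℓ ≤ I.ℓ * I.n := Nat.le_mul_of_pos_right _ hn1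
    omega
  refine .mono (Does.forLoop (cb := (I.n + 1) * ((3 ^ I.k + 3) * 1000)) (I.ℓ - 1) ?_ I.LevelInv hℓw
    (by decide) ?_ (hM.congr (by simp [write_of_ne]) (by simp [write_of_ne])) ?_ fun _ _ h => h)
    (N₁ := (I.ℓ - 1 + 1) * ((I.n + 2) * ((3 ^ I.k + 3) * 1000)))
    (by rw [Nat.sub_add_cancel hℓ])
  · have : (Exp.read 0 3 - 1).weight + (Exp.read 0 3 - 1).width + 40 ≤ 100 := by decide
    rw [show (I.n + 2) * ((3 ^ I.k + 3) * 1000) = (I.n + 1) * ((3 ^ I.k + 3) * 1000) +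
      (3 ^ I.k + 3) * 1000 by ring]
    have : 0 < 3 ^ I.k := by positivity
    omega
  · intro m' hm'
    simp [hm' 0 (by decide), hE.input.ℓ]
  · intro i m₁ hi hf₁ hv₁ ih₁
    have hE₁ := hE.of_agreeOff hf₁ (by decide)
    refine Does.forLoop (cb := (3 ^ I.k + 2) * 1000) I.n ?_ (I.MergeInv i) hw.n (by decide) ?_
      (ih₁.mergeInv.congr (by simp [write_of_ne]) (by simp [write_of_ne])) ?_ ?_
    · have : (Exp.var 0).weight + (Exp.var 0).width + 40 ≤ 100 := by decide
      omega
    · intro m' hm'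
      simp [hm' 0 (by decide), hE₁.input.n]
    · intro u m₂ hu hf₂ hv₂ ih₂
      refine (mergeUserCmd_does (hE₁.of_agreeOff hf₂ (by decide)) hw hC
        (by rw [hf₂ 20 (by decide), hv₁]) hv₂ (by omega) hu ih₂).imp fun m₃ _ h _ => ?_
      exact h.congr (by simp [write_of_ne]) (by simp [write_of_ne])
    · intro m' _ h _
      exact h.levelInv.congr (by simp [write_of_ne]) (by simp [write_of_ne])

/-! ### Reading off the answer, and the whole program -/

/-- The last cell of the table of the top block, or zero if it is bad. -/
def resultExp : Exp :=
  .read 15 (.read 16 ((.read 0 3 - 1) * .var 0 + .read 7 (.var 0 * (.read 0 3 - 1))) * masksExp +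
    (masksExp - 1)) * (1 - .read 14 ((.read 0 3 - 1) * masksExp + (masksExp - 1)))

/-- Writes the answer. -/
def outputCmd : Cmd :=
  .seq (.store 24 0 resultExp) (.ite (.var 24)
    (.seq (.store 8 0 1) (.forLoop 23 stepsExp (.store 8 (.var 23 + 1)
      ((.var 24 - 1) / .read 10 (.var 23) -
        .var 0 * ((.var 24 - 1) / .read 10 (.var 23) / .var 0)))))
    .skip)

/-- The memory holds a plan, or it reports that there is none. -/
def Inst.Answer (I : Inst) (m : Mem) : Prop :=
  (m 8 0 = 1 ∧ ∃ π, I.Ok I.ℓ (Set.Iio I.n) (range I.k) π ∧ ∀ s < I.k, m 8 (s + 1) = π s) ∨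
  (m 8 0 = 0 ∧ ¬ ∃ π, I.Ok I.ℓ (Set.Iio I.n) (range I.k) π)

/-- The top block is the set of all users, found through the label of user `0`. Its table takes
account of the levels below the top one only, so the badness test of the top level is applied to the
full set of steps, whose code is `2 ^ k - 1`. The plan is then decoded digit by digit in base `n`.
-/
theorem outputCmd_does {I : Inst} {w : ℕ} {m : Mem} (hE : Env I m) (hw : Fits I w)
    (hC : I.Canonical) (hM : I.LevelInv (I.ℓ - 1) m) (h8 : m 8 0 = 0) :
    Does w outputCmd ((I.k + 2) * 1000) m I.Answer := by
  have hn1 := hw.n_pos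
  have hℓ := hC.ℓ_pos
  have hn := hE.input.n
  have hL := hE.input.L (I.ℓ - 1) 0
  rw [add_zero] at hL
  set b := I.L (I.ℓ - 1) 0 with hb
  have hbn : b < I.n := hC.L_lt _ (by omega) 0 hn1
  have hblock : I.block (I.ℓ - 1) b = Set.Iio I.n := by
    ext v
    exact ⟨fun h => h.1, fun h => ⟨h, hC.top v h 0 hn1⟩⟩
  have hrep := (hM.rep b hbn).goodTab hE (b := b) fun x hx => hx.2
  rw [hblock, Nat.sub_add_cancel hℓ] at hrep
  set p := m 16 ((I.ℓ - 1) * I.n + b) with hp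
  have hval : resultExp.eval m = I.goodTab m (I.ℓ - 1) p (mask (range I.k)) := by
    simp [resultExp, masksExp, stepsExp, hE.input.k, hE.input.ℓ, (hE.powers I.k le_rfl).1, hn, hL,
      Inst.goodTab, Inst.tab, mask_range, ← hp]
  have hle : I.goodTab m (I.ℓ - 1) p (mask (range I.k)) ≤ I.n ^ I.k := by
    rcases hrep _ subset_rfl with ⟨h, -⟩ | ⟨π, h, h'⟩
    · rw [h]
      exact Nat.zero_le _
    · rw [h']
      exact code_lt subset_rfl hn1 fun s hs => (h.1 s hs).1
  refine .mono (.seq (.mono (.store (by rw [hval]; exact hle.trans_lt hw.n_pow) fun _ => ?_)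
    (by decide))) (N₁ := 200 + ((I.k + 1) * 1000 + 100)) (by omega)
  simp only [hval, Exp.eval_zero]
  set z := I.goodTab m (I.ℓ - 1) p (mask (range I.k)) with hz
  refine .mono (.ite (N := (I.k + 1) * 1000 + 20) (fun h => ?_) fun h => ?_) ?_
  · simp only [Exp.eval_var, write_self] at h
    obtain ⟨π, hπ, e⟩ := hrep.exists_code subset_rfl h
    have hπn : ∀ s < I.k, π s < I.n := fun s hs => (hπ.1 s (mem_range.2 hs)).1
    have h1 : 1 < 2 ^ w := (Nat.one_le_pow _ _ (by simp)).trans_lt hw.three_pow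
    refine .mono (.seq (.mono (.store h1 fun _ => Does.forLoop (cb := 500) (C := 900) I.k (by decide)
      (fun j m' => m' 8 0 = 1 ∧ ∀ s < j, m' 8 (s + 1) = π s) hw.k (by decide) ?_ ?_ ?_ ?_)
        (N₂ := 20) (by decide))) (by omega)
    · intro m' hm'
      simp [stepsExp, hm' 0 (by decide), write_of_ne, hE.input.k]
    · simp [write_of_ne]
    · intro s m' hs hf hv ⟨i1, i2⟩
      have hf0 : AgreeOff [8, 23, 24] m m' := by
        intro a ha
        rw [hf a (by simp at ha; simp [Cmd.mods, ha])]
        simp only [List.mem_cons, not_or] at ha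
        simp [write_of_ne, ha]
      have h24 : m' 24 0 = z := by
        rw [hf 24 (by decide)]
        simp [write_of_ne]
      have h0 : m' 0 0 = I.n := by rw [hf0 0 (by decide), hn]
      have h10 : m' 10 s = I.n ^ s := by rw [hf0 10 (by decide), (hE.powers s hs.le).2.1]
      have hd : (z - 1) / I.n ^ s - I.n * ((z - 1) / I.n ^ s / I.n) = π s := by
        rw [← code_range_div_mod hπn hs, hz, e, Nat.add_sub_cancel, Nat.sub_eq_of_eq_add]
        exact (Nat.mod_add_div _ _).symm
      have hlt := (hπn s hs).trans hw.n
      refine .mono (.store (by simpa [hv, h24, h0, h10, hd] using hlt) fun _ => ?_) (by decide)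
      simp only [Exp.eval_add, Exp.eval_sub, Exp.eval_div, Exp.eval_mul, Exp.eval_var, Exp.eval_read,
        Exp.eval_one, hv, h24, h0, h10, hd]
      rw [write_of_ne (by simp)]
      refine ⟨by simpa [write_apply] using i1, fun s' hs' => ?_⟩
      rw [write_apply]
      rcases Nat.lt_succ_iff_lt_or_eq.1 hs' with hs' | rfl
      · rw [if_neg (by omega), i2 s' hs']
      · rw [if_pos rfl]
    · intro m' _ ⟨i1, i2⟩
      exact .inl ⟨i1, π, hπ, i2⟩
  · simp only [Exp.eval_var, write_self] at h
    refine .mono (.skip (.inr ⟨by simp [write_of_ne, h8], ?_⟩)) (by omega)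
    exact fun h' => (hrep.ne_zero_iff subset_rfl).2 h' h
  · have : (Exp.var 24).weight + 1 ≤ 10 := by decide
    omega

/-- Decides the workflow satisfiability problem. -/
def mainCmd : Cmd :=
  .seq powersCmd (.seq ternaryCmd (.seq badCmd (.seq usersCmd (.seq levelsCmd outputCmd))))

/-- A label carried by a user denotes a singleton block; a label carried by nobody has pointer `0`,
the table of the empty set. -/
theorem UsersInv.levelInv {I : Inst} {m : Mem} (hC : I.Canonical) (h : UsersInv I I.n m) :
    I.LevelInv 0 m where
  empty := h.empty
  zero p hp := h.zero p (by omega)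
  ptr_lt b _ := by
    rw [zero_mul, zero_add]
    by_cases hb : ∃ v < I.n, I.L 0 v = b
    · obtain ⟨v, hv, rfl⟩ := hb
      rw [h.ptr v hv]
      omega
    · rw [h.ptr_zero b fun v hv h => hb ⟨v, hv, h⟩]
      omega
  rep b _ := by
    rw [zero_mul, zero_add]
    by_cases hb : ∃ v < I.n, I.L 0 v = b
    · obtain ⟨v, hv, rfl⟩ := hb
      have : I.block 0 (I.L 0 v) = {v} := by
        ext u
        simp only [Inst.block, Set.mem_ofPred_eq, Set.mem_singleton_iff]
        exact ⟨fun h => hC.bot u h.1 v hv h.2, by rintro rfl; exact ⟨hv, rfl⟩⟩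
      rw [this, h.ptr v hv]
      refine Inst.rep_singleton v fun F hF => ?_
      rw [h.cell v hv F hF, Inst.userCell]
      split_ifs with hau
      · exact .inl ⟨hau, rfl⟩
      · exact .inr ⟨hau, rfl⟩
    · have : I.block 0 b = ∅ := Set.eq_empty_of_forall_notMem fun v hv => hb ⟨v, hv⟩
      rw [this, h.ptr_zero b fun v hv h => hb ⟨v, hv, h⟩]
      exact Inst.rep_empty 0 h.empty
  next a ha := h.ptr_zero a fun v hv hva => by
    have := hC.L_lt 0 hC.ℓ_pos v hv
    omega

theorem mainCmd_does {I : Inst} {w : ℕ} {m : Mem} (hI : Input I m) (h8 : ∀ a ≥ 8, ∀ x, m a x = 0)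
    (hw : Fits I w) (hC : I.Canonical) :
    Does w mainCmd (200 * (I.k + 1) + ((3 ^ I.k + 1) * 700 +
      ((I.c + 1) * ((2 ^ I.k + 2) * ((I.k + 1) * 1400)) +
      ((I.n + 2) * ((2 ^ I.k + 2) * ((I.k + 1) * 1000)) +
      (I.ℓ * ((I.n + 2) * ((3 ^ I.k + 3) * 1000)) + (I.k + 2) * 1000))))) m I.Answer := by
  refine .seq (.imp (powersCmd_does hI hw) fun m₁ f₁ p₁ _ => ?_)
  have I₁ := hI.of_agreeOff f₁ (by decide)
  refine .seq (.imp (ternaryCmd_does I₁ hw p₁ ?_ ?_) fun m₂ f₂ t₂ _ => ?_)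
  · rw [f₁ 12 (by decide)]
    exact h8 12 (by simp)
  · rw [f₁ 13 (by decide)]
    exact h8 13 (by simp)
  have I₂ := I₁.of_agreeOff f₂ (by decide)
  have p₂ := p₁.of_agreeOff f₂ (by decide) (by decide) (by decide)
  refine .seq (.imp (badCmd_does I₂ hw p₂ ?_) fun m₃ f₃ b₃ _ => ?_)
  · rw [f₂ 14 (by decide), f₁ 14 (by decide)]
    exact h8 14 (by simp)
  have E₃ : Env I m₃ := {
    input := I₂.of_agreeOff f₃ (by decide)
    powers := p₂.of_agreeOff f₃ (by decide) (by decide) (by decide)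
    ternary := by rwa [f₃ 12 (by decide), f₃ 13 (by decide)]
    bad := b₃ }
  refine .seq (.imp (usersCmd_does E₃.input hw E₃.powers ?_ ?_ hC.bot) fun m₄ f₄ u₄ _ => ?_)
  · rw [f₃ 15 (by decide), f₂ 15 (by decide), f₁ 15 (by decide)]
    exact h8 15 (by simp)
  · rw [f₃ 16 (by decide), f₂ 16 (by decide), f₁ 16 (by decide)]
    exact h8 16 (by simp)
  have E₄ := E₃.of_agreeOff f₄ (by decide)
  refine .seq (.imp (levelsCmd_does E₄ hw hC (u₄.levelInv hC)) fun m₅ f₅ l₅ _ => ?_)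
  refine outputCmd_does (E₄.of_agreeOff f₅ (by decide)) hw hC l₅ ?_
  rw [f₅ 8 (by decide), f₄ 8 (by decide), f₃ 8 (by decide), f₂ 8 (by decide), f₁ 8 (by decide)]
  exact h8 8 (by simp) 0

/-! ## The time bound -/

/-- Each term is compared with `T * (k + 1)` for `T = 3 ^ k * n * (c + n)`. The merges dominate with
`n * n * 3 ^ k ≤ T`, thanks to `ℓ ≤ n`; the bad sets need `(c + 1) * 3 ^ k ≤ T`, which uses `1 ≤ n`.
-/
theorem steps_le {n k c ℓ : ℕ} (hn : 0 < n) (hℓ : ℓ ≤ n) :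
    200 * (k + 1) + ((3 ^ k + 1) * 700 + ((c + 1) * ((2 ^ k + 2) * ((k + 1) * 1400)) +
      ((n + 2) * ((2 ^ k + 2) * ((k + 1) * 1000)) +
      (ℓ * ((n + 2) * ((3 ^ k + 3) * 1000)) + (k + 2) * 1000)))) ≤
    30000 * (3 ^ k * n * (c + n) * (k + 1)) := by
  have hX : 2 ^ k ≤ 3 ^ k := Nat.pow_le_pow_left (by simp) k
  have hX1 : 1 ≤ 3 ^ k := Nat.one_le_pow _ _ (by simp)
  generalize 3 ^ k = X at *
  generalize 2 ^ k = Y at *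
  set T := X * n * (c + n) with hT
  have h1 : X ≤ T := by
    rw [hT, mul_assoc]
    exact Nat.le_mul_of_pos_right _ (Nat.mul_pos hn (by omega))
  have h2 : (c + 1) * X ≤ T := by
    rw [hT, mul_comm]
    exact Nat.mul_le_mul (Nat.le_mul_of_pos_right _ hn) (by omega)
  have h3 : n * n * X ≤ T := by
    rw [hT, mul_comm, mul_assoc]
    exact Nat.mul_le_mul_left _ (Nat.mul_le_mul_left _ (by omega))
  have h4 : n * X ≤ n * n * X := Nat.mul_le_mul_right _ (Nat.le_mul_of_pos_right _ hn)
  have a1 : (k + 1) ≤ T * (k + 1) := Nat.le_mul_of_pos_left _ (by omega)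
  have a2 : T ≤ T * (k + 1) := Nat.le_mul_of_pos_right _ (by omega)
  have a3 : (c + 1) * ((Y + 2) * ((k + 1) * 1400)) ≤ 4200 * (T * (k + 1)) := by
    calc (c + 1) * ((Y + 2) * ((k + 1) * 1400)) ≤ (c + 1) * ((3 * X) * ((k + 1) * 1400)) := by
          gcongr; omega
      _ = 4200 * (((c + 1) * X) * (k + 1)) := by ring
      _ ≤ _ := by gcongr
  have a4 : (n + 2) * ((Y + 2) * ((k + 1) * 1000)) ≤ 9000 * (T * (k + 1)) := by
    calc (n + 2) * ((Y + 2) * ((k + 1) * 1000)) ≤ (3 * n) * ((3 * X) * ((k + 1) * 1000)) := by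
          gcongr <;> omega
      _ = 9000 * ((n * X) * (k + 1)) := by ring
      _ ≤ _ := Nat.mul_le_mul_left _ (Nat.mul_le_mul_right _ (h4.trans h3))
  have a5 : ℓ * ((n + 2) * ((X + 3) * 1000)) ≤ 12000 * (T * (k + 1)) := by
    calc ℓ * ((n + 2) * ((X + 3) * 1000)) ≤ n * ((3 * n) * ((4 * X) * 1000)) := by
          gcongr <;> omega
      _ = 12000 * (n * n * X) := by ring
      _ ≤ _ := Nat.mul_le_mul_left _ (h3.trans a2)
  omega

/-- The word length that suffices for the program. -/
def wordLength (n k c : ℕ) : ℕ := (k + 2) * (n.size + c.size + 4)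

theorem size_le_log {x T : ℕ} (h : x ≤ T) : x.size ≤ Nat.log 2 T + 1 :=
  Nat.size_le.2 (h.trans_lt (Nat.lt_pow_succ_log_self (by simp) T))

/-- With `L = log T + 1`, the factor `k + 1` costs one power of `L` and the word length two, whence
the exponent `3`; the constant is `30000 * 13`. -/
theorem time_le {n k c : ℕ} (hn : 0 < n) :
    30000 * (3 ^ k * n * (c + n) * (k + 1)) * (wordLength n k c + 1) ≤
      softBound 390000 3 (3 ^ k * n * (c + n)) := by
  have hX1 : 1 ≤ 3 ^ k := Nat.one_le_pow _ _ (by simp)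
  set T := 3 ^ k * n * (c + n) with hT
  have h1 : 3 ^ k ≤ T := by
    rw [hT, mul_assoc]
    exact Nat.le_mul_of_pos_right _ (Nat.mul_pos hn (by omega))
  have h2 : c + n ≤ T := Nat.le_mul_of_pos_left _ (Nat.mul_pos (by omega) hn)
  have hk : k ≤ Nat.log 2 T :=
    Nat.le_log_of_pow_le (by simp) ((Nat.pow_le_pow_left (by simp) k).trans h1)
  have hsn := size_le_log (show n ≤ T by omega)
  have hsc := size_le_log (show c ≤ T by omega)
  rw [softBound]
  set L := Nat.log 2 T + 1 with hL
  -- From `k + 1 ≤ L` and `1 ≤ L` one has `k + 2 ≤ 2 * L`, and the second factor is at most `2 * L +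
  -- 4 ≤ 6 * L`.
  have hw : wordLength n k c + 1 ≤ 13 * L ^ 2 := by
    have : wordLength n k c ≤ (2 * L) * (6 * L) := Nat.mul_le_mul (by omega) (by omega)
    nlinarith
  calc 30000 * (T * (k + 1)) * (wordLength n k c + 1) ≤ 30000 * (T * L) * (13 * L ^ 2) := by
        gcongr; omega
    _ = _ := by ring

theorem lt_two_pow_wordLength {x n k c e : ℕ} (h : x < 2 ^ e) (he : e ≤ wordLength n k c) :
    x < 2 ^ wordLength n k c :=
  h.trans_le (Nat.pow_le_pow_right (by simp) he)

theorem le_wordLength (n k c : ℕ) : 2 * n.size + 2 * c.size + 2 * k + 8 ≤ wordLength n k c := by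
  rw [wordLength]
  nlinarith

theorem n_lt_wordLength (n k c : ℕ) : n < 2 ^ wordLength n k c :=
  lt_two_pow_wordLength (Nat.lt_size_self n) (by have := le_wordLength n k c; omega)

theorem c_lt_wordLength (n k c : ℕ) : c < 2 ^ wordLength n k c :=
  lt_two_pow_wordLength (Nat.lt_size_self c) (by have := le_wordLength n k c; omega)

/-- The longest numbers are the codes of plans, up to `n ^ k`; they force the product of `k` and
`n.size` in the word length. -/
theorem fits_wordLength {I : Inst} (hn : 0 < I.n) (hℓ : I.ℓ ≤ I.n) (hau : ∀ s u, I.au s u ≤ 1)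
    (h₁ : ∀ j s, I.s₁ j s ≤ 1) (h₂ : ∀ j s, I.s₂ j s ≤ 1) : Fits I (wordLength I.n I.k I.c) where
  n_pos := hn
  au_le := hau
  s₁_le := h₁
  s₂_le := h₂
  n_pow := by
    have h : I.n ^ I.k ≤ 2 ^ (I.n.size * I.k) := by
      rw [pow_mul]
      exact Nat.pow_le_pow_left (Nat.lt_size_self _).le _
    refine h.trans_lt (Nat.pow_lt_pow_right (by simp) ?_)
    rw [wordLength]
    nlinarith
  three_pow := by
    have h : 3 ^ I.k ≤ 2 ^ (2 * I.k) := by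
      rw [pow_mul]
      exact Nat.pow_le_pow_left (by simp) _
    refine h.trans_lt (Nat.pow_lt_pow_right (by simp) ?_)
    have := le_wordLength I.n I.k I.c
    omega
  c := c_lt_wordLength _ _ _
  tables := by
    have h := Nat.lt_size_self I.n
    refine lt_two_pow_wordLength (e := I.n.size + I.n.size + 1) ?_
      (by have := le_wordLength I.n I.k I.c; omega)
    rw [pow_succ, pow_add]
    nlinarith

/-! ## Hierarchies -/

/-- Choose in each block of `Q` a block of `P`. The choice is injective, so by equality of the
cardinalities it exhausts `P`. A point of `b` lies in some chosen block, which can only be the one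
chosen in `b`; thus `b` equals its chosen block. -/
theorem eq_of_le_of_card_eq {U : Type*} [Fintype U] [DecidableEq U]
    {P Q : Finpartition (univ : Finset U)} (h : P ≤ Q) (hc : Q.parts.card = P.parts.card) :
    P = Q := by
  choose! f hf hfc using fun b (hb : b ∈ Q.parts) => Finpartition.exists_le_of_le h hb
  have hne : ∀ b ∈ Q.parts, (f b).Nonempty := fun b hb => P.nonempty_of_mem_parts (hf b hb)
  have hinj : Set.InjOn f Q.parts := by
    intro b hb b' hb' e
    obtain ⟨x, hx⟩ := hne b hb
    exact Q.eq_of_mem_parts hb hb' (hfc b hb hx) (hfc b' hb' (e ▸ hx))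
  have hsurj : Q.parts.image f = P.parts := by
    refine eq_of_subset_of_card_le (image_subset_iff.2 hf) ?_
    rw [card_image_of_injOn hinj, hc]
  have hsub : Q.parts ⊆ P.parts := by
    intro b hb
    have : f b = b := by
      refine (hfc b hb).antisymm fun x hx => ?_
      obtain ⟨p, hp, hxp⟩ := P.exists_mem (mem_univ x)
      rw [← hsurj, mem_image] at hp
      obtain ⟨b', hb', rfl⟩ := hp
      rwa [Q.eq_of_mem_parts hb hb' hx (hfc b' hb' hxp)]
    rw [← this]
    exact hf b hb
  exact Finpartition.ext (eq_of_subset_of_card_le hsub hc.ge).symm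

/-- The number of blocks drops by at least one from each level to the next, starts at no more than
the number of users and ends at `1`. -/
theorem Hierarchy.IsCanonical.levels_le_card {U : Type*} [Fintype U] [DecidableEq U] {ℓ : ℕ}
    {H : Hierarchy U ℓ} (hH : H.IsCanonical) : ℓ ≤ Fintype.card U := by
  have key : ∀ i (hi : i < ℓ), (H.level ⟨i, hi⟩).parts.card + i ≤ Fintype.card U := by
    intro i
    induction i with
    | zero => exact fun hi => (H.level ⟨0, hi⟩).card_parts_le_card
    | succ i ih =>
      intro hi
      have h1 := ih (by omega)
      have h2 := Finpartition.card_mono (H.refines i hi)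
      have h3 : (H.level ⟨i + 1, hi⟩).parts.card ≠ (H.level ⟨i, Nat.lt_of_succ_lt hi⟩).parts.card :=
        fun h => hH.ne_succ i hi (eq_of_le_of_card_eq (H.refines i hi) h)
      omega
  have := key (ℓ - 1) (by have := hH.pos; omega)
  rw [hH.top, card_singleton] at this
  omega

theorem Hierarchy.Same.succ {U : Type*} [Fintype U] [DecidableEq U] {ℓ : ℕ} {H : Hierarchy U ℓ}
    {i : ℕ} (hi : i + 1 < ℓ) {u v : U} (h : H.Same ⟨i, Nat.lt_of_succ_lt hi⟩ u v) :
    H.Same ⟨i + 1, hi⟩ u v := by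
  obtain ⟨B, hB, hu, hv⟩ := h
  obtain ⟨B', hB', hle⟩ := H.refines i hi hB
  exact ⟨B', hB', hle hu, hle hv⟩

theorem Hierarchy.IsCanonical.eq_of_same {U : Type*} [Fintype U] [DecidableEq U] {ℓ : ℕ}
    {H : Hierarchy U ℓ} (hH : H.IsCanonical) {u v : U} (h : H.Same ⟨0, hH.pos⟩ u v) : u = v := by
  obtain ⟨B, hB, hu, hv⟩ := h
  rw [hH.bot, mem_image] at hB
  obtain ⟨w, -, rfl⟩ := hB
  rw [mem_singleton] at hu hv
  rw [hu, hv]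

theorem Hierarchy.IsCanonical.same_top {U : Type*} [Fintype U] [DecidableEq U] {ℓ : ℕ}
    {H : Hierarchy U ℓ} (hH : H.IsCanonical) (u v : U) :
    H.Same ⟨ℓ - 1, Nat.sub_lt hH.pos Nat.one_pos⟩ u v :=
  ⟨univ, by simp [hH.top], mem_univ u, mem_univ v⟩

/-! ## The instance in the initial memory -/

/-- The instance that the input arrays of a memory hold. -/
def Inst.ofMem (m : Mem) : Inst where
  n := m 0 0
  k := m 0 1
  c := m 0 2
  ℓ := m 0 3
  au s u := m 2 (m 0 0 * s + u)
  sg j := m 3 j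
  ix j := m 4 j
  s₁ j s := m 5 (m 0 1 * j + s)
  s₂ j s := m 6 (m 0 1 * j + s)
  L i u := m 7 (m 0 0 * i + u)

theorem input_ofMem (m : Mem) : Input (.ofMem m) m := by
  constructor <;> intros <;> rfl

theorem vector_lt {p : ℕ} (f : Fin p → ℕ) (i : Fin p) : vector f i = f i := by
  simp [vector]

theorem vector_le {p B : ℕ} {f : Fin p → ℕ} (h : ∀ i, f i ≤ B) (x : ℕ) : vector f x ≤ B := by
  unfold vector
  split_ifs
  · exact h _
  · exact Nat.zero_le _

theorem table_apply {p q : ℕ} (f : Fin p → Fin q → ℕ) (i : Fin p) (j : Fin q) :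
    table f (q * i + j) = f i j := by
  have h : q * (i : ℕ) + j = (finProdFinEquiv (i, j) : Fin (p * q)) := by
    simp [finProdFinEquiv, add_comm]
  rw [h, table, vector_lt, Equiv.symm_apply_apply]

theorem table_le {p q B : ℕ} {f : Fin p → Fin q → ℕ} (h : ∀ i j, f i j ≤ B) (x : ℕ) :
    table f x ≤ B :=
  vector_le (fun _ => h _ _) x

theorem bit_le (P : Prop) : bit P ≤ 1 := by
  unfold bit
  split_ifs <;> simp

theorem bit_ne_zero {P : Prop} : bit P ≠ 0 ↔ P := by
  unfold bit
  split_ifs with h <;> simp [h]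

section Link

variable {n k c ℓ : ℕ} {H : Hierarchy (Fin n) ℓ} {W : Workflow (Fin k) (Fin n) (RelSymbol ℓ) c}
  {lab : Fin ℓ → Fin n → ℕ}

/-- The instance in the initial memory. -/
noncomputable abbrev theInst (W : Workflow (Fin k) (Fin n) (RelSymbol ℓ) c)
    (lab : Fin ℓ → Fin n → ℕ) : Inst :=
  .ofMem (inputMem W lab)

theorem theInst_k : (theInst W lab).k = k := rfl
theorem theInst_ℓ : (theInst W lab).ℓ = ℓ := rfl

theorem theInst_au (s : Fin k) (u : Fin n) : (theInst W lab).au s u = bit (W.auth s u) :=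
  table_apply (fun (s : Fin k) (u : Fin n) => bit (W.auth s u)) s u

theorem theInst_sg (j : Fin c) : (theInst W lab).sg j = (W.con j).rel.sign :=
  vector_lt (fun j => (W.con j).rel.sign) j

theorem theInst_ix (j : Fin c) : (theInst W lab).ix j = (W.con j).rel.index :=
  vector_lt (fun j => (W.con j).rel.index) j

theorem theInst_s₁ (j : Fin c) (s : Fin k) :
    (theInst W lab).s₁ j s = bit (s ∈ (W.con j).left) :=
  table_apply (fun j s => bit (s ∈ (W.con j).left)) j s

theorem theInst_s₂ (j : Fin c) (s : Fin k) :
    (theInst W lab).s₂ j s = bit (s ∈ (W.con j).right) :=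
  table_apply (fun j s => bit (s ∈ (W.con j).right)) j s

theorem theInst_L (i : Fin ℓ) (u : Fin n) : (theInst W lab).L i u = lab i u :=
  table_apply lab i u

theorem theInst_canonical (hH : H.IsCanonical) (hlab : IsLabelling H lab) :
    (theInst W lab).Canonical where
  ℓ_pos := hH.pos
  L_lt i hi u hu := by
    have := theInst_L (W := W) (lab := lab) ⟨i, hi⟩ ⟨u, hu⟩
    rw [this]
    exact (hlab _ _).1
  refines i hi u hu v hv h := by
    have e1 := theInst_L (W := W) (lab := lab) ⟨i, Nat.lt_of_succ_lt hi⟩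
    have e2 := theInst_L (W := W) (lab := lab) ⟨i + 1, hi⟩
    have e3 := e1 ⟨u, hu⟩
    have e4 := e1 ⟨v, hv⟩
    have e5 := e2 ⟨u, hu⟩
    have e6 := e2 ⟨v, hv⟩
    dsimp only at e3 e4 e5 e6
    rw [e3, e4, ((hlab _ _).2 _)] at h
    rw [e5, e6, ((hlab _ _).2 _)]
    exact Hierarchy.Same.succ hi h
  bot u hu v hv h := by
    have e1 := theInst_L (W := W) (lab := lab) ⟨0, hH.pos⟩
    have e3 := e1 ⟨u, hu⟩
    have e4 := e1 ⟨v, hv⟩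
    dsimp only at e3 e4
    rw [e3, e4, ((hlab _ _).2 _)] at h
    exact congrArg Fin.val (hH.eq_of_same h)
  top u hu v hv := by
    have e1 := theInst_L (W := W) (lab := lab) ⟨ℓ - 1, Nat.sub_lt hH.pos Nat.one_pos⟩
    have e3 := e1 ⟨u, hu⟩
    have e4 := e1 ⟨v, hv⟩
    dsimp only at e3 e4
    rw [theInst_ℓ, e3, e4, ((hlab _ _).2 _)]
    exact hH.same_top _ _

theorem pos_of_isCanonical (hH : H.IsCanonical) : 0 < n := by
  rcases Nat.eq_zero_or_pos n with rfl | h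
  · have := hH.levels_le_card
    have := hH.pos
    simp at *
    omega
  · exact h

theorem theInst_fits (hH : H.IsCanonical) : Fits (theInst W lab) (wordLength n k c) := by
  refine fits_wordLength (I := theInst W lab) (pos_of_isCanonical hH) ?_ ?_ ?_ ?_
  · exact hH.levels_le_card.trans_eq (Fintype.card_fin n)
  · exact fun s u => table_le (f := fun (s : Fin k) (u : Fin n) => bit (W.auth s u))
      (fun _ _ => bit_le _) _
  · exact fun j s => table_le (f := fun j s => bit (s ∈ (W.con j).left)) (fun _ _ => bit_le _) _
  · exact fun j s => table_le (f := fun j s => bit (s ∈ (W.con j).right)) (fun _ _ => bit_le _) _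

theorem bounded_inputMem (hH : H.IsCanonical) (hlab : IsLabelling H lab) :
    Bounded (wordLength n k c) (inputMem W lab) := by
  have hf := theInst_fits (W := W) (lab := lab) hH
  have hn := n_lt_wordLength n k c
  have hn1 := pos_of_isCanonical hH
  have hℓ := hH.levels_le_card
  have hbit : ∀ {p q : ℕ} (P : Fin p → Fin q → Prop) (x : ℕ),
      table (fun i j => bit (P i j)) x < 2 ^ wordLength n k c := fun P x =>
    (table_le (fun _ _ => bit_le _) x).trans_lt (by omega)
  intro a x
  match a with
  | 0 =>
    show vector ![n, k, c, ℓ] x < _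
    unfold vector
    split_ifs with h
    · rw [Fintype.card_fin] at hℓ
      have := hf.k
      have := hf.c
      interval_cases x
      · exact hn
      · exact hf.k
      · exact hf.c
      · exact hℓ.trans_lt hn
    · positivity
  | 1 => exact hbit _ x
  | 2 => exact hbit _ x
  | 3 =>
    refine (vector_le (B := 1) (f := fun j => (W.con j).rel.sign) (fun j => ?_) x).trans_lt (by omega)
    cases (W.con j).rel <;> simp [RelSymbol.sign]
  | 4 =>
    refine (vector_le (B := n) (f := fun j => (W.con j).rel.index) (fun j => ?_) x).trans_lt hn
    rw [Fintype.card_fin] at hℓ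
    cases (W.con j).rel <;> simp only [RelSymbol.index] <;> omega
  | 5 => exact hbit (fun j s => s ∈ (W.con j).left) x
  | 6 => exact hbit (fun j s => s ∈ (W.con j).right) x
  | 7 => exact (table_le (B := n) (fun i u => (hlab i u).1.le) x).trans_lt hn
  | _ + 8 => exact Nat.pos_of_ne_zero (by positivity)

/-! ### Valid plans -/

/-- If no pair differs and one set is `{s}`, all of `S₁ ∪ S₂` has the value `b = g s`. For two
larger sets the same holds unless one is empty; a singleton excludes that case by supplying `b`. -/
theorem exists_ne_iff {S : Type*} {S₁ S₂ : Finset S} (h : S₁.card = 1 ∨ S₂.card = 1) (g : S → ℕ) :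
    (∃ s₁ ∈ S₁, ∃ s₂ ∈ S₂, g s₁ ≠ g s₂) ↔
      ∀ b, ¬ ((∃ s, g s = b) ∧ (∀ s ∈ S₁, g s = b) ∧ ∀ s ∈ S₂, g s = b) := by
  constructor
  · rintro ⟨s₁, h₁, s₂, h₂, hne⟩ b ⟨-, hb₁, hb₂⟩
    exact hne ((hb₁ s₁ h₁).trans (hb₂ s₂ h₂).symm)
  · intro hb
    by_contra! hno
    rcases h with h | h <;> obtain ⟨s, rfl⟩ := card_eq_one.1 h
    · exact hb (g s) ⟨⟨s, rfl⟩, by simp, fun s' hs' => (hno s (by simp) s' hs').symm⟩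
    · exact hb (g s) ⟨⟨s, rfl⟩, fun s' hs' => hno s' hs' s (by simp), by simp⟩

/-- Here the singleton is essential: if no pair agrees, the class `b = g s` of its element `s`
contains that set and misses the other. For two larger sets with disjoint sets of values there need
be no such class. -/
theorem exists_eq_iff {S : Type*} {S₁ S₂ : Finset S} (h : S₁.card = 1 ∨ S₂.card = 1) (g : S → ℕ) :
    (∃ s₁ ∈ S₁, ∃ s₂ ∈ S₂, g s₁ = g s₂) ↔
      ∀ b, ¬ ((∃ s, g s = b) ∧ (((∀ s ∈ S₁, g s = b) ∧ ∀ s ∈ S₂, g s ≠ b) ∨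
        ((∀ s ∈ S₂, g s = b) ∧ ∀ s ∈ S₁, g s ≠ b))) := by
  constructor
  · rintro ⟨s₁, h₁, s₂, h₂, heq⟩ b ⟨-, ⟨hb₁, hb₂⟩ | ⟨hb₁, hb₂⟩⟩
    · exact hb₂ s₂ h₂ (heq.symm.trans (hb₁ s₁ h₁))
    · exact hb₂ s₁ h₁ (heq.trans (hb₁ s₂ h₂))
  · intro hb
    by_contra! hno
    rcases h with h | h <;> obtain ⟨s, rfl⟩ := card_eq_one.1 h
    · exact hb (g s) ⟨⟨s, rfl⟩, .inl ⟨by simp, fun s' hs' => (hno s (by simp) s' hs').symm⟩⟩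
    · exact hb (g s) ⟨⟨s, rfl⟩, .inr ⟨by simp, fun s' hs' => hno s' hs' s (by simp)⟩⟩

variable {π : ℕ → ℕ} {σ : Fin k → Fin n}

/-- The passage from pairs of steps to blocks: satisfaction is a condition on each label class
separately. The label `b` runs over all numbers; those that are not the label of a used block give
the empty set and are discarded by nonemptiness. -/
theorem satisfiedBy_iff (hlab : IsLabelling H lab) (j : Fin c) (h2 : (W.con j).IsType2)
    (hπ : ∀ s : Fin k, π s = σ s) :
    (W.con j).SatisfiedBy H.interp σ ↔ ∀ b,
      ¬ (((range k).filter fun s => (theInst W lab).L ((theInst W lab).ix j) (π s) = b).Nonempty ∧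
        (theInst W lab).Viol j
          ((range k).filter fun s => (theInst W lab).L ((theInst W lab).ix j) (π s) = b)) := by
  obtain ⟨i, hi⟩ : ∃ i : Fin ℓ, (W.con j).rel.index = i := by
    cases (W.con j).rel with
    | same i => exact ⟨i, rfl⟩
    | diff i => exact ⟨i, rfl⟩
  have hL : ∀ s : Fin k, (theInst W lab).L i (π s) = lab i (σ s) := fun s => by
    rw [hπ, theInst_L]
  have hne : ∀ b, ((range k).filter fun s => (theInst W lab).L i (π s) = b).Nonempty ↔
      ∃ s : Fin k, lab i (σ s) = b := by
    intro b
    constructor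
    · rintro ⟨s, hs⟩
      rw [mem_filter, mem_range] at hs
      exact ⟨⟨s, hs.1⟩, by rw [← hL]; exact hs.2⟩
    · rintro ⟨s, hs⟩
      exact ⟨s, by simp [hL, hs]⟩
  have hsub : ∀ b (f : ℕ → ℕ) (S' : Finset (Fin k)), (∀ s : Fin k, f s = bit (s ∈ S')) →
      ((∀ s < k, f s ≠ 0 → s ∈ (range k).filter fun s => (theInst W lab).L i (π s) = b) ↔
        ∀ s ∈ S', lab i (σ s) = b) := by
    intro b f S' hf
    constructor
    · intro h s hs
      have := h s s.2 (by rw [hf, bit_ne_zero]; exact hs)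
      rw [mem_filter, hL] at this
      exact this.2
    · intro h s hs hfs
      have := hf ⟨s, hs⟩
      dsimp only at this
      rw [this, bit_ne_zero] at hfs
      rw [mem_filter, mem_range]
      exact ⟨hs, (hL ⟨s, hs⟩).trans (h _ hfs)⟩
  have hdis : ∀ b (f : ℕ → ℕ) (S' : Finset (Fin k)), (∀ s : Fin k, f s = bit (s ∈ S')) →
      ((∀ s < k, f s ≠ 0 → s ∉ (range k).filter fun s => (theInst W lab).L i (π s) = b) ↔
        ∀ s ∈ S', lab i (σ s) ≠ b) := by
    intro b f S' hf
    constructor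
    · intro h s hs hb
      refine h s s.2 (by rw [hf, bit_ne_zero]; exact hs) ?_
      rw [mem_filter, hL]
      exact ⟨mem_range.2 s.2, hb⟩
    · intro h s hs hfs hmem
      have := hf ⟨s, hs⟩
      dsimp only at this
      rw [this, bit_ne_zero] at hfs
      rw [mem_filter] at hmem
      exact h _ hfs ((hL ⟨s, hs⟩).symm.trans hmem.2)
  have hv : ∀ b, (theInst W lab).Viol j
      ((range k).filter fun s => (theInst W lab).L i (π s) = b) ↔
      ((W.con j).rel.sign ≠ 0 ∧ (∀ s ∈ (W.con j).left, lab i (σ s) = b) ∧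
        ∀ s ∈ (W.con j).right, lab i (σ s) = b) ∨
      ((W.con j).rel.sign = 0 ∧
        (((∀ s ∈ (W.con j).left, lab i (σ s) = b) ∧ ∀ s ∈ (W.con j).right, lab i (σ s) ≠ b) ∨
        ((∀ s ∈ (W.con j).right, lab i (σ s) = b) ∧ ∀ s ∈ (W.con j).left, lab i (σ s) ≠ b))) := by
    intro b
    rw [Inst.Viol, theInst_sg, theInst_k, hsub b _ _ (theInst_s₁ j), hsub b _ _ (theInst_s₂ j),
      hdis b _ _ (theInst_s₁ j), hdis b _ _ (theInst_s₂ j)]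
  rw [theInst_ix, hi]
  simp only [hne, hv]
  unfold Constraint.SatisfiedBy
  cases hr : (W.con j).rel with
  | same i' =>
    rw [hr] at hi
    obtain rfl : i' = i := Fin.ext hi
    simp only [Hierarchy.interp, RelSymbol.sign, ne_eq, not_true_eq_false, false_and, true_and,
      false_or, ← (hlab _ _).2]
    exact exists_eq_iff h2 fun s => lab i' (σ s)
  | diff i' =>
    rw [hr] at hi
    obtain rfl : i' = i := Fin.ext hi
    simp only [Hierarchy.interp, RelSymbol.sign, ne_eq, one_ne_zero, not_false_eq_true, true_and,
      false_and, or_false, ← (hlab _ _).2]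
    exact exists_ne_iff h2 fun s => lab i' (σ s)

theorem isValid_iff (hlab : IsLabelling H lab) (h2 : ∀ j, (W.con j).IsType2)
    (hπ : ∀ s : Fin k, π s = σ s) :
    W.IsValid H.interp σ ↔ (theInst W lab).Ok ℓ (Set.Iio n) (range k) π := by
  refine and_congr ?_ ?_
  · constructor
    · intro h s hs
      have hs' := mem_range.1 hs
      have := hπ ⟨s, hs'⟩
      dsimp only at this
      rw [this]
      exact ⟨(σ ⟨s, hs'⟩).2, by
        have := theInst_au (W := W) (lab := lab) ⟨s, hs'⟩ (σ ⟨s, hs'⟩)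
        dsimp only at this
        rw [this, bit_ne_zero]
        exact h _⟩
    · intro h s
      have := (h s (mem_range.2 s.2)).2
      rwa [hπ, theInst_au, bit_ne_zero] at this
  · simp only [fun j => satisfiedBy_iff hlab j (h2 j) hπ]
    constructor
    · rintro h i - b ⟨hne, j, hj, rfl, hv⟩
      exact h ⟨j, hj⟩ b ⟨hne, hv⟩
    · rintro h j b ⟨hne, hv⟩
      refine h ((theInst W lab).ix j) ?_ b ⟨hne, j, j.2, rfl, hv⟩
      rw [theInst_ix]
      cases (W.con j).rel with
      | same i => exact i.2
      | diff i => exact i.2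

theorem isAnswer_of_answer (hlab : IsLabelling H lab) (h2 : ∀ j, (W.con j).IsType2) {m : Mem}
    (h : (theInst W lab).Answer m) : IsAnswer H W m := by
  refine h.imp (fun ⟨h8, π, hok, hm⟩ => ⟨h8, ?_⟩) fun ⟨h8, hno⟩ => ⟨h8, fun ⟨σ, hσ⟩ => hno ?_⟩
  · have hπ : ∀ s : Fin k, π s < n := fun s => (hok.1 s (mem_range.2 s.2)).1
    exact ⟨fun s => ⟨π s, hπ s⟩, (isValid_iff hlab h2 fun _ => rfl).2 hok, fun s => hm s s.2⟩
  · exact ⟨fun s => if hs : s < k then σ ⟨s, hs⟩ else 0,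
      (isValid_iff hlab h2 fun s => by simp).1 hσ⟩

end Link

end WSP

theorem theorem7 :
    ∃ (P : WSP.Cmd) (K d : ℕ), ∀ (n k c ℓ : ℕ)
      (H : WSP.Hierarchy (Fin n) ℓ) (_ : H.IsCanonical)
      (W : WSP.Workflow (Fin k) (Fin n) (WSP.RelSymbol ℓ) c) (_ : ∀ j, (W.con j).IsType2)
      (lab : Fin ℓ → Fin n → ℕ) (_ : WSP.IsLabelling H lab),
      ∃ (t : ℕ) (m : WSP.Mem),
        WSP.Exec P (WSP.inputMem W lab) t m ∧
        t ≤ WSP.softBound K d (3 ^ k * n * (c + n)) ∧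
        WSP.IsAnswer H W m := by
  refine ⟨WSP.mainCmd, 390000, 3, fun n k c ℓ H hH W h2 lab hlab => ?_⟩
  have hn := WSP.pos_of_isCanonical hH
  have hℓ : ℓ ≤ n := by simpa using hH.levels_le_card
  obtain ⟨t, m, he, ht, -, hm⟩ := WSP.mainCmd_does (I := WSP.theInst W lab) (WSP.input_ofMem _)
    (fun a ha x => by obtain ⟨a, rfl⟩ := Nat.exists_eq_add_of_le' ha; rfl)
    (WSP.theInst_fits hH) (WSP.theInst_canonical hH hlab) (WSP.bounded_inputMem hH hlab)
  refine ⟨t, m, he, ?_, WSP.isAnswer_of_answer hlab h2 hm⟩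
  exact ht.trans ((Nat.mul_le_mul_right _ (WSP.steps_le hn hℓ)).trans (WSP.time_le hn))
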